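/- All spaces are Banach spaces over $\mathbb F=\mathbb R$ or $\mathbb C$, and bases are Schauder bases indexed by $\mathbb N$. For a basis $\mathcal B=(x_j)_{j\ge1}$ of $X$ with coordinate functionals $(x_j^*)$, put $S_A(f)=\sum_{j\in A}x_j^*(f)\,x_j$ for $A\subseteq\mathbb N$ finite, and $$\varphi_m[\mathcal B]=\sup_{|A|\le m}\Big\|\sum_{j\in A}x_j\Big\|,\qquad L_m[\mathcal B]=\sup\Big\{\frac{\|S_A(f)\|}{\|f\|}:\ f\ne0,\ x_j^*(f)=0\text{ for } j>m,\ A\subseteq\mathbb N\text{ finite}\Big\}.$$ The basis is of type P if $\sup_k\|\sum_{j=1}^kx_j\|<\infty$ and $\inf_j\|x_j\|>0$. It is semi-normalized if $0<\inf_j\|x_j\|\le\sup_j\|x_j\|<\infty$. It is unconditional if $\sup_{A\text{ finite}}\|S_A\|<\infty$. It is subsymmetric if it is unconditional and equivalent to all of its subsequences $(x_{\phi(j)})_{j\ge1}$ ($\phi$ strictly increasing), i.e. for each such $\phi$ there is $C$ with $C^{-1}\|\sum a_jx_j\|\le\|\sum a_jx_{\phi(j)}\|\le C\|\sum a_jx_j\|$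 for all finitely supported scalar sequences $(a_j)$. It is almost greedy if there is a constant $C$ such that $\|f-S_F(f)\|\le C\|f-S_A(f)\|$ whenever $f\in X$ and $A,F$ are finite sets with $|A|\le|F|$ and $|x_j^*(f)|\le|x_k^*(f)|$ for all $j\notin F$, $k\in F$. A space has nontrivial type if it has Rademacher type $p$ for some $1<p\le2$. We write $\alpha_m\approx\beta_m$ if each is at most a constant times the other, with the constant independent of $m$. **Theorem.** Let $X$ be a Banach space with a basis of type P and let $S$ be a Banach space with a subsymmetric basis $(e_j)_{j\ge1}$. Assume that $S$ is isomorphic to a complemented subspace of $X$ and that $S$ has nontrivial type. Then $X$ has a semi-normalized almost greedy basis $\mathcal B_\kappa$ such that $$\varphi_m[\mathcal B_\kappa]\approx\Big\|\sum_{j=1}^me_j\Big\|_S\quad(m\ge1)\qquad\text{and}\qquad L_m[\mathcal B_\kappa]\approx\log m\quad(m\ge2).$$ -/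

import Mathlib

namespace GreedyBases

noncomputable section

/-- `α m ≈ β m` for `m ∈ I`: the two families of numbers are equivalent up to a constant. -/
def EquivOn (I : Set ℕ) (α β : ℕ → ℝ) : Prop :=
  ∃ C : ℝ, 0 < C ∧ ∀ m ∈ I, α m ≤ C * β m ∧ β m ≤ C * α m

section Bases

variable {𝕜 : Type*} [RCLike 𝕜] {X : Type*} [NormedAddCommGroup X] [NormedSpace 𝕜 X]

/-- `0 < inf_j ‖x_j‖ ≤ sup_j ‖x_j‖ < ∞`. -/
def SemiNormalized (b : SchauderBasis 𝕜 X) : Prop :=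
  ∃ c C : ℝ, 0 < c ∧ ∀ j, c ≤ ‖b j‖ ∧ ‖b j‖ ≤ C

/-- The coordinate projections `S_A` on finite sets are uniformly bounded. -/
def Unconditional (b : SchauderBasis 𝕜 X) : Prop :=
  ∃ C : ℝ, ∀ A : Finset ℕ, ‖GeneralSchauderBasis.proj b A‖ ≤ C

/-- Equivalence of two sequences of vectors:
`‖∑ a_j x_j‖ ≈ ‖∑ a_j y_j‖` uniformly over finitely supported scalar families. -/
def EquivSeq (𝕜 : Type*) [RCLike 𝕜] {X Y : Type*} [NormedAddCommGroup X] [NormedSpace 𝕜 X]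
    [NormedAddCommGroup Y] [NormedSpace 𝕜 Y] (x : ℕ → X) (y : ℕ → Y) : Prop :=
  ∃ C : ℝ, 0 < C ∧ ∀ (F : Finset ℕ) (a : ℕ → 𝕜),
    ‖∑ j ∈ F, a j • x j‖ ≤ C * ‖∑ j ∈ F, a j • y j‖ ∧
    ‖∑ j ∈ F, a j • y j‖ ≤ C * ‖∑ j ∈ F, a j • x j‖

/-- A basis is subsymmetric if it is unconditional and equivalent to all of its subsequences. -/
def Subsymmetric (b : SchauderBasis 𝕜 X) : Prop :=
  Unconditional b ∧ ∀ φ : ℕ → ℕ, StrictMono φ → EquivSeq 𝕜 (fun j => b j) (fun j => b (φ j))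

/-- Bases of type P: `sup_k ‖∑_{j ≤ k} x_j‖ < ∞` and `inf_j ‖x_j‖ > 0`. -/
def TypeP (b : SchauderBasis 𝕜 X) : Prop :=
  (∃ C : ℝ, ∀ k : ℕ, ‖∑ j ∈ Finset.range k, b j‖ ≤ C) ∧ ∃ c : ℝ, 0 < c ∧ ∀ j, c ≤ ‖b j‖

/-- `F` is a greedy set of `f`: the coefficients of `f` outside `F` are, in modulus, no larger
than those on `F`. -/
def IsGreedySet (b : SchauderBasis 𝕜 X) (f : X) (F : Finset ℕ) : Prop :=
  ∀ j ∉ F, ∀ k ∈ F, ‖b.coord j f‖ ≤ ‖b.coord k f‖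

/-- Almost greedy bases: up to a constant, greedy approximation is at least as good as any
coordinate projection with no more terms. -/
def AlmostGreedy (b : SchauderBasis 𝕜 X) : Prop :=
  ∃ C : ℝ, ∀ (f : X) (A F : Finset ℕ), A.card ≤ F.card → IsGreedySet b f F →
    ‖f - GeneralSchauderBasis.proj b F f‖ ≤ C * ‖f - GeneralSchauderBasis.proj b A f‖

/-- The fundamental function `φ_m = sup_{|A| ≤ m} ‖∑_{j ∈ A} x_j‖`. -/
def fundamentalFunction (b : SchauderBasis 𝕜 X) (m : ℕ) : ℝ :=
  sSup {r : ℝ | ∃ A : Finset ℕ, A.card ≤ m ∧ r = ‖∑ j ∈ A, b j‖}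

/-- The conditionality constant `L_m`, the supremum of `‖S_A f‖ / ‖f‖` over the nonzero `f`
supported on the first `m` basis vectors (indices start at `0` here). For such `f` one has
`S_A f = S_{A ∩ {0, …, m - 1}} f`, so that finite sets `A` suffice. -/
def conditionalityConstant (b : SchauderBasis 𝕜 X) (m : ℕ) : ℝ :=
  sSup {r : ℝ | ∃ (f : X) (A : Finset ℕ), f ≠ 0 ∧ (∀ j, m ≤ j → b.coord j f = 0) ∧
    r = ‖GeneralSchauderBasis.proj b A f‖ / ‖f‖}

/-- On a semi-normalized basis, the supremum defining `φ_m` is finite. -/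
theorem bddAbove_fundamentalFunction (b : SchauderBasis 𝕜 X) (hb : SemiNormalized b) (m : ℕ) :
    BddAbove {r : ℝ | ∃ A : Finset ℕ, A.card ≤ m ∧ r = ‖∑ j ∈ A, b j‖} := by
  obtain ⟨c, C, hc, h⟩ := hb
  refine ⟨m * C, ?_⟩
  rintro r ⟨A, hA, rfl⟩
  have hC : 0 ≤ C := hc.le.trans ((h 0).1.trans (h 0).2)
  calc ‖∑ j ∈ A, b j‖ ≤ ∑ j ∈ A, ‖b j‖ := norm_sum_le _ _
    _ ≤ ∑ _j ∈ A, C := Finset.sum_le_sum fun j _ => (h j).2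
    _ = A.card * C := by simp
    _ ≤ m * C := by gcongr

/-- The supremum defining `L_m` is finite. -/
theorem bddAbove_conditionalityConstant (b : SchauderBasis 𝕜 X) (m : ℕ) :
    BddAbove {r : ℝ | ∃ (f : X) (A : Finset ℕ), f ≠ 0 ∧ (∀ j, m ≤ j → b.coord j f = 0) ∧
      r = ‖GeneralSchauderBasis.proj b A f‖ / ‖f‖} := by
  refine ⟨∑ j ∈ Finset.range m, ‖b.coord j‖ * ‖b j‖, ?_⟩
  rintro r ⟨f, A, hf, hs, rfl⟩
  rw [div_le_iff₀ (norm_pos_iff.mpr hf), GeneralSchauderBasis.proj_apply]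
  have h1 : ∑ j ∈ A, b.coord j f • b j = ∑ j ∈ A ∩ Finset.range m, b.coord j f • b j := by
    symm
    refine Finset.sum_subset Finset.inter_subset_left fun j hj hj' => ?_
    have hmj : m ≤ j := by simp_all
    simp [hs j hmj]
  rw [h1, Finset.sum_mul]
  calc _ ≤ ∑ j ∈ A ∩ Finset.range m, ‖b.coord j f • b j‖ := norm_sum_le _ _
    _ ≤ ∑ j ∈ Finset.range m, ‖b.coord j f • b j‖ :=
        Finset.sum_le_sum_of_subset_of_nonneg Finset.inter_subset_right
          fun _ _ _ => norm_nonneg _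
    _ ≤ _ := Finset.sum_le_sum fun j _ => by
        rw [norm_smul]
        calc _ ≤ (‖b.coord j‖ * ‖f‖) * ‖b j‖ := by
              gcongr; exact (b.coord j).le_opNorm f
          _ = _ := by ring

end Bases

/-- Rademacher type `p`, with the expectation over `n` independent signs written as an average
over all choices of signs. -/
def HasType (X : Type*) [NormedAddCommGroup X] (p : ℝ) : Prop :=
  ∃ T : ℝ, ∀ (n : ℕ) (x : Fin n → X),
    ((∑ ε : Fin n → ℤˣ, ‖∑ i, (ε i : ℤ) • x i‖ ^ p) / 2 ^ n) ^ (1 / p) ≤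
      T * (∑ i, ‖x i‖ ^ p) ^ (1 / p)

/-- Nontrivial type: type `p` for some `1 < p ≤ 2`. -/
def HasNontrivialType (X : Type*) [NormedAddCommGroup X] : Prop :=
  ∃ p : ℝ, 1 < p ∧ p ≤ 2 ∧ HasType X p

/-- `S ≲_c X`: the space `S` is isomorphic to a complemented subspace of `X`. -/
def ComplementablyEmbeds (𝕜 : Type*) [RCLike 𝕜] (S X : Type*)
    [NormedAddCommGroup S] [NormedSpace 𝕜 S] [NormedAddCommGroup X] [NormedSpace 𝕜 X] : Prop :=
  ∃ (L : S →L[𝕜] X) (T : X →L[𝕜] S), T.comp L = ContinuousLinearMap.id 𝕜 S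

end

end GreedyBases

/-! Write `Λ m` for the norm of the sum of the first `m` vectors of `e`. The plan, in the spirit of
Dilworth, Kalton and Kutzarova, is to hide a very conditional basis `y` of `X` inside a basis
governed by `e`, placing one vector `y n` on the whole `n`-th dyadic level of indices, which has `2
^ n` elements. The indices below `m` meet about `log m` levels, so conditionality of order `N` of
the first `N` vectors of `y` becomes conditionality of order `log m`.

In detail, averaging the coordinates of `e` over dyadic levels is a bounded projection `q` of `S`.
In a space that splits as `X ⊕ ker q`, an index `k` of level `n` receives the vector `(Λ (2 ^ n) / 2
^ n) y n + (e k - q (e k))`. A coefficient is then a part common to the level, coming from `X`, plus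
a part with zero sum on each level, coming from `ker q`. Projections onto full levels act diagonally
on the two summands (`Gluing.sum_range_pow`), and projections inside one level are uniformly bounded
(`Gluing.norm_sum_level_le`). This yields a Schauder basis and both bounds for the conditionality
constants.

Democracy with fundamental function `Λ` holds because the weights over a set `D` add up to at most a
multiple of `Λ |D|` (`Spreading.sum_weight_le`). This needs `∑_{n ≤ r} Λ (2 ^ n) ≲ Λ (2 ^ r)`, the
only consequence of nontrivial type that is used (`Spreading.sum_sumNorm_le`). Quasi-greediness
follows by comparing a greedy set with the initial segment of full levels of about the same size,
and the two properties give almost greediness.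

Two facts remain. First, `X ≅ X ⊕ ker q`: since `S` is complemented in `X`, it suffices that `S ≅ S
⊕ ker q`, which is shown by averaging over a self-similar refinement of the dyadic partition
(`Spreading.exists_absorption`). Second, `y` exists: from a basis of type P one builds a bounded
basis whose conditionality constants grow linearly (`TypeP.exists_conditional`). -/

namespace GreedyBases

noncomputable section

open Finset Filter Topology

/-! ### Domination between sequences. -/

section Equivalence

variable {𝕜 : Type*} [RCLike 𝕜] {X Y Z : Type*} [NormedAddCommGroup X] [NormedSpace 𝕜 X]
  [NormedAddCommGroup Y] [NormedSpace 𝕜 Y] [NormedAddCommGroup Z] [NormedSpace 𝕜 Z]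

/-- The sequence `x` is dominated by the sequence `y` with constant `C`. -/
def Dominated (𝕜 : Type*) [RCLike 𝕜] {X Y : Type*} [NormedAddCommGroup X] [NormedSpace 𝕜 X]
    [NormedAddCommGroup Y] [NormedSpace 𝕜 Y] (C : ℝ) (x : ℕ → X) (y : ℕ → Y) : Prop :=
  ∀ (F : Finset ℕ) (a : ℕ → 𝕜), ‖∑ j ∈ F, a j • x j‖ ≤ C * ‖∑ j ∈ F, a j • y j‖

theorem Dominated.mono {C D : ℝ} {x : ℕ → X} {y : ℕ → Y} (h : Dominated 𝕜 C x y) (hCD : C ≤ D) :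
    Dominated 𝕜 D x y := fun F a =>
  (h F a).trans (by gcongr)

theorem Dominated.trans {C D : ℝ} {x : ℕ → X} {y : ℕ → Y} {z : ℕ → Z} (hC : 0 ≤ C)
    (h : Dominated 𝕜 C x y) (h' : Dominated 𝕜 D y z) : Dominated 𝕜 (C * D) x z := fun F a =>
  (h F a).trans (by rw [mul_assoc]; gcongr; exact h' F a)

theorem Dominated.comp {C : ℝ} {x : ℕ → X} {y : ℕ → Y} (h : Dominated 𝕜 C x y) {g : ℕ → ℕ}
    (hg : g.Injective) : Dominated 𝕜 C (fun j => x (g j)) (fun j => y (g j)) := fun F a => by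
  have := h (F.image g) (fun i => a (Function.invFun g i))
  rw [sum_image hg.injOn, sum_image hg.injOn] at this
  simpa only [Function.leftInverse_invFun hg _] using this

end Equivalence

/-! ### Uniform constants for subsymmetric bases. -/

section Subsymmetric

variable {𝕜 : Type*} [RCLike 𝕜] {S : Type*} [NormedAddCommGroup S] [NormedSpace 𝕜 S]

/-- Baire category: the increasing maps form a Polish space, covered by the closed sets of those
with equivalence constant `n`. One of these contains a cylinder, and any increasing sequence that
starts far enough can be grafted onto the finite prefix defining it. -/
theorem exists_uniform_of_tail (e : ℕ → S)
    (he : ∀ φ : ℕ → ℕ, StrictMono φ → EquivSeq 𝕜 e (fun j => e (φ j))) :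
    ∃ (C : ℝ) (N : ℕ), 0 < C ∧ ∀ ψ : ℕ → ℕ, StrictMono ψ → N ≤ ψ 0 →
      Dominated 𝕜 C e (fun j => e (ψ j)) ∧ Dominated 𝕜 C (fun j => e (ψ j)) e := by
  have hclosed : IsClosed {φ : ℕ → ℕ | StrictMono φ} := by
    have : {φ : ℕ → ℕ | StrictMono φ} = ⋂ i : ℕ, {φ | φ i < φ (i + 1)} := by
      ext φ
      simp only [Set.mem_ofPred_eq, Set.mem_iInter]
      exact ⟨fun h i => h (Nat.lt_succ_self i), strictMono_nat_of_lt_succ⟩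
    rw [this]
    refine isClosed_iInter fun i => ?_
    have hcont : Continuous fun φ : ℕ → ℕ => (φ i, φ (i + 1)) :=
      (continuous_apply i).prodMk (continuous_apply (i + 1))
    exact (isClosed_discrete {p : ℕ × ℕ | p.1 < p.2}).preimage hcont
  let M := {φ : ℕ → ℕ // StrictMono φ}
  have : PolishSpace M := hclosed.polishSpace
  have : Nonempty M := ⟨⟨id, strictMono_id⟩⟩
  have hcts : ∀ (F : Finset ℕ) (a : ℕ → 𝕜),
      Continuous fun φ : M => ‖∑ j ∈ F, a j • e (φ.1 j)‖ := fun F a => by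
    refine (continuous_finsetSum _ fun j _ => ?_).norm
    have h1 : Continuous fun i : ℕ => a j • e i := continuous_of_discreteTopology
    exact h1.comp ((continuous_apply j).comp continuous_subtype_val)
  let f : ℕ → Set M := fun n => {φ | Dominated 𝕜 n e (fun j => e (φ.1 j)) ∧
    Dominated 𝕜 n (fun j => e (φ.1 j)) e}
  have hf : ∀ n, IsClosed (f n) := fun n => by
    simp only [f, Dominated, Set.ofPred_and, Set.ofPred_forall]
    refine IsClosed.inter ?_ ?_
    · exact isClosed_iInter fun F => isClosed_iInter fun a =>
        isClosed_le continuous_const (continuous_const.mul (hcts F a))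
    · exact isClosed_iInter fun F => isClosed_iInter fun a =>
        isClosed_le (hcts F a) continuous_const
  have hU : ⋃ n, f n = Set.univ := by
    refine Set.eq_univ_of_forall fun φ => ?_
    obtain ⟨C, hC, h⟩ := he φ.1 φ.2
    obtain ⟨n, hn⟩ := exists_nat_ge C
    refine Set.mem_iUnion.2 ⟨n, ?_, ?_⟩
    · exact Dominated.mono (fun F a => (h F a).1) hn
    · exact Dominated.mono (fun F a => (h F a).2) hn
  obtain ⟨n, φ₀, hφ₀⟩ := nonempty_interior_of_iUnion_of_closed hf hU
  obtain ⟨V, hV, hVU⟩ := isOpen_induced_iff.1 (isOpen_interior (s := f n))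
  have hφV : φ₀.1 ∈ V := by
    have : φ₀ ∈ Subtype.val ⁻¹' V := hVU ▸ hφ₀
    exact this
  obtain ⟨I, u, hu, huV⟩ := isOpen_pi_iff.1 hV φ₀.1 hφV
  let m := I.sup id + 1
  have hm : ∀ i ∈ I, i < m := fun i hi => Nat.lt_succ_of_le (le_sup (f := id) hi)
  have key : ∀ ψ : ℕ → ℕ, StrictMono ψ → φ₀.1 m ≤ ψ 0 →
      Dominated 𝕜 n (fun j => e (j + m)) (fun j => e (ψ j)) ∧
      Dominated 𝕜 n (fun j => e (ψ j)) (fun j => e (j + m)) := by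
    intro ψ hψ hψ0
    -- Keeping `φ₀` below `m` keeps the graft in the open set; its part from `m` on is `ψ`.
    let φ : ℕ → ℕ := fun i => if i < m then φ₀.1 i else ψ (i - m)
    have hφ : StrictMono φ := by
      refine strictMono_nat_of_lt_succ fun i => ?_
      simp only [φ]
      split_ifs with h1 h2 h2
      · exact φ₀.2 (Nat.lt_succ_self i)
      · have : φ₀.1 i < φ₀.1 m := φ₀.2 h1
        have : ψ 0 ≤ ψ (i + 1 - m) := hψ.monotone (Nat.zero_le _)
        omega
      · omega
      · exact hψ (by omega)
    have hmem : (⟨φ, hφ⟩ : M) ∈ f n := by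
      refine interior_subset (s := f n) ?_
      rw [← hVU]
      refine huV fun i hi => ?_
      have : φ i = φ₀.1 i := if_pos (hm i hi)
      simpa only [this] using (hu i hi).2
    have hinj : Function.Injective fun j : ℕ => j + m := add_left_injective m
    have h1 := hmem.1.comp hinj
    have h2 := hmem.2.comp hinj
    have : (fun j => e (φ (j + m))) = fun j => e (ψ j) := by
      funext j; simp [φ]
    rw [this] at h1 h2
    exact ⟨h1, h2⟩
  obtain ⟨C, hC, h⟩ := he (fun j => j + m) (fun i j hij => by simpa using hij)
  refine ⟨C * n + n * C + 1, φ₀.1 m, by positivity, fun ψ hψ hψ0 => ?_⟩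
  obtain ⟨h1, h2⟩ := key ψ hψ hψ0
  constructor
  · refine (Dominated.trans hC.le (fun F a => (h F a).1) h1).mono ?_
    nlinarith [mul_nonneg hC.le (Nat.cast_nonneg (α := ℝ) n)]
  · refine (Dominated.trans (Nat.cast_nonneg n) h2 (fun F a => (h F a).2)).mono ?_
    nlinarith [mul_nonneg hC.le (Nat.cast_nonneg (α := ℝ) n)]

/-- A sequence equivalent to all its subsequences is so uniformly. -/
theorem exists_uniform_subsequences (e : ℕ → S)
    (he : ∀ φ : ℕ → ℕ, StrictMono φ → EquivSeq 𝕜 e (fun j => e (φ j))) :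
    ∃ C : ℝ, 1 ≤ C ∧ ∀ φ : ℕ → ℕ, StrictMono φ →
      Dominated 𝕜 C e (fun j => e (φ j)) ∧ Dominated 𝕜 C (fun j => e (φ j)) e := by
  obtain ⟨C, N, hC, hN⟩ := exists_uniform_of_tail (𝕜 := 𝕜) e he
  obtain ⟨D, hD, h⟩ := he (fun j => j + N) (fun i j hij => by simpa using hij)
  have hd1 : Dominated 𝕜 D e (fun j => e (j + N)) := fun F a => (h F a).1
  have hd2 : Dominated 𝕜 D (fun j => e (j + N)) e := fun F a => (h F a).2
  refine ⟨C * D + D * C + 1, by nlinarith [mul_pos hC hD], fun φ hφ => ?_⟩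
  -- The map `φ + N` starts beyond `N`; along `φ`, the shift by `N` costs only the constant `D`.
  obtain ⟨h1, h2⟩ := hN (fun j => φ j + N) (fun i j hij => by simpa using hφ hij)
    (Nat.le_add_left _ _)
  constructor
  · exact (h1.trans hC.le (hd2.comp hφ.injective)).mono (by nlinarith [mul_pos hC hD])
  · exact ((hd1.comp hφ.injective).trans hD.le h2).mono (by nlinarith [mul_pos hC hD])

/-- Quantitative form of being a subsymmetric sequence, with a single constant for
restrictions to subsets, bounded multipliers, and increasing rearrangements. -/
structure Spreading (e : SchauderBasis 𝕜 S) (K : ℝ) : Prop where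
  one_le : 1 ≤ K
  subset : ∀ (A B : Finset ℕ) (a : ℕ → 𝕜), A ⊆ B →
    ‖∑ j ∈ A, a j • e j‖ ≤ K * ‖∑ j ∈ B, a j • e j‖
  proj : ∀ (A : Finset ℕ) (f : S), ‖∑ j ∈ A, e.coord j f • e j‖ ≤ K * ‖f‖
  mult : ∀ (A : Finset ℕ) (a b : ℕ → 𝕜), (∀ j ∈ A, ‖a j‖ ≤ ‖b j‖) →
    ‖∑ j ∈ A, a j • e j‖ ≤ K * ‖∑ j ∈ A, b j • e j‖
  spread : ∀ (A : Finset ℕ) (π : ℕ → ℕ) (a : ℕ → 𝕜), StrictMonoOn π A →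
    ‖∑ j ∈ A, a j • e (π j)‖ ≤ K * ‖∑ j ∈ A, a j • e j‖
  unspread : ∀ (A : Finset ℕ) (π : ℕ → ℕ) (a : ℕ → 𝕜), StrictMonoOn π A →
    ‖∑ j ∈ A, a j • e j‖ ≤ K * ‖∑ j ∈ A, a j • e (π j)‖

theorem coord_sum (e : SchauderBasis 𝕜 S) (B : Finset ℕ) (a : ℕ → 𝕜) (j : ℕ) :
    e.coord j (∑ i ∈ B, a i • e i) = if j ∈ B then a j else 0 := by
  classical
  simp [map_sum, e.ortho, Pi.single_apply]

/-- Convexity: a multiplier in `[0, 1]` on one coordinate is a convex combination of deleting and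
keeping it. `F` holds the coordinates still to be deleted or kept, `G` those being multiplied; the
second alternative only discards overlapping pairs. -/
theorem norm_sum_mul_le_of_subset {e : ℕ → S} {K : ℝ}
    (h : ∀ (A B : Finset ℕ) (a : ℕ → 𝕜), A ⊆ B →
      ‖∑ j ∈ A, a j • e j‖ ≤ K * ‖∑ j ∈ B, a j • e j‖)
    (G : Finset ℕ) : ∀ (F : Finset ℕ) (a : ℕ → 𝕜) (l : ℕ → ℝ), (∀ j, 0 ≤ l j ∧ l j ≤ 1) →
      (∀ A ⊆ F, ‖∑ j ∈ A, a j • e j + ∑ j ∈ G, ((l j : 𝕜) * a j) • e j‖ ≤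
        K * ‖∑ j ∈ F ∪ G, a j • e j‖) ∨ ¬ Disjoint F G := by
  induction G using Finset.induction_on with
  | empty =>
    intro F a l _
    left
    intro A hA
    simpa using h A F a hA
  | insert i G hi ih =>
    intro F a l hl
    by_cases hd : Disjoint F (insert i G)
    · left
      intro A hA
      rw [disjoint_insert_right] at hd
      have hd' : Disjoint (insert i F) G := by
        rw [disjoint_insert_left]; exact ⟨hi, hd.2⟩
      have hiA : i ∉ A := fun hiA => hd.1 (hA hiA)
      have h1 := ((ih (insert i F) a l hl).resolve_right (not_not.2 hd'))
      have hu : insert i F ∪ G = F ∪ insert i G := by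
        ext; simp
      rw [hu] at h1
      have h2 := h1 A (hA.trans (subset_insert _ _))
      have h3 := h1 (insert i A) (insert_subset_insert _ hA)
      rw [sum_insert hiA] at h3
      rw [sum_insert hi]
      set P := ∑ j ∈ A, a j • e j
      set Q := ∑ j ∈ G, ((l j : 𝕜) * a j) • e j
      have heq : P + (((l i : 𝕜) * a i) • e i + Q) =
          ((1 - l i : ℝ) : 𝕜) • (P + Q) + ((l i : ℝ) : 𝕜) • (a i • e i + P + Q) := by
        push_cast
        simp only [smul_add, sub_smul, one_smul, mul_smul]
        abel
      rw [heq]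
      refine (norm_add_le _ _).trans ?_
      rw [norm_smul, norm_smul, RCLike.norm_of_nonneg (by linarith [(hl i).2]),
        RCLike.norm_of_nonneg (hl i).1]
      nlinarith [mul_le_mul_of_nonneg_left h2 (sub_nonneg.2 (hl i).2),
        mul_le_mul_of_nonneg_left h3 (hl i).1]
    · right; exact hd

/-- The quotient `a / b` splits into the positive and negative parts of its real and imaginary
parts, four multipliers with values in `[0, 1]`. -/
theorem norm_sum_mult_le {e : ℕ → S} {K : ℝ}
    (h : ∀ (A B : Finset ℕ) (a : ℕ → 𝕜), A ⊆ B →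
      ‖∑ j ∈ A, a j • e j‖ ≤ K * ‖∑ j ∈ B, a j • e j‖)
    (A : Finset ℕ) (a b : ℕ → 𝕜) (hab : ∀ j ∈ A, ‖a j‖ ≤ ‖b j‖) :
    ‖∑ j ∈ A, a j • e j‖ ≤ 4 * K * ‖∑ j ∈ A, b j • e j‖ := by
  have hunit : ∀ l : ℕ → ℝ, (∀ j, 0 ≤ l j ∧ l j ≤ 1) →
      ‖∑ j ∈ A, ((l j : 𝕜) * b j) • e j‖ ≤ K * ‖∑ j ∈ A, b j • e j‖ := fun l hl => by
    have := ((norm_sum_mul_le_of_subset h A ∅ b l hl).resolve_right (by simp)) ∅ le_rfl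
    simpa using this
  let c : ℕ → 𝕜 := fun j => if j ∈ A then a j / b j else 0
  have hc : ∀ j, ‖c j‖ ≤ 1 := fun j => by
    simp only [c]
    split_ifs with hj
    · rw [norm_div]; exact div_le_one_of_le₀ (hab j hj) (norm_nonneg _)
    · simp
  have hca : ∀ j ∈ A, a j = c j * b j := fun j hj => by
    simp only [c, if_pos hj]
    by_cases hb : b j = 0
    · have := hab j hj
      rw [hb, norm_zero, norm_le_zero_iff] at this
      simp [this, hb]
    · field_simp
  have hre : ∀ j, |RCLike.re (c j)| ≤ 1 := fun j => (RCLike.abs_re_le_norm _).trans (hc j)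
  have him : ∀ j, |RCLike.im (c j)| ≤ 1 := fun j => (RCLike.abs_im_le_norm _).trans (hc j)
  have hpos : ∀ r : ℝ, |r| ≤ 1 → 0 ≤ r⁺ ∧ r⁺ ≤ 1 := fun r hr =>
    ⟨posPart_nonneg r, by rw [posPart_def]; exact sup_le (le_of_abs_le hr) zero_le_one⟩
  have hneg : ∀ r : ℝ, |r| ≤ 1 → 0 ≤ r⁻ ∧ r⁻ ≤ 1 := fun r hr =>
    ⟨negPart_nonneg r, by
      rw [negPart_def]; exact sup_le ((neg_le_abs r).trans hr) zero_le_one⟩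
  have hdec : ∀ j, c j = ((RCLike.re (c j))⁺ : ℝ) - ((RCLike.re (c j))⁻ : ℝ) +
      RCLike.I * (((RCLike.im (c j))⁺ : ℝ) - ((RCLike.im (c j))⁻ : ℝ)) := fun j => by
    rw [← RCLike.ofReal_sub, ← RCLike.ofReal_sub, posPart_sub_negPart, posPart_sub_negPart,
      mul_comm, RCLike.re_add_im]
  have hsum : ∑ j ∈ A, a j • e j =
      ∑ j ∈ A, ((((RCLike.re (c j))⁺ : ℝ) : 𝕜) * b j) • e j -
      ∑ j ∈ A, ((((RCLike.re (c j))⁻ : ℝ) : 𝕜) * b j) • e j +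
      (RCLike.I : 𝕜) • (∑ j ∈ A, ((((RCLike.im (c j))⁺ : ℝ) : 𝕜) * b j) • e j -
      ∑ j ∈ A, ((((RCLike.im (c j))⁻ : ℝ) : 𝕜) * b j) • e j) := by
    rw [← sum_sub_distrib, ← sum_sub_distrib, smul_sum, ← sum_add_distrib]
    refine sum_congr rfl fun j hj => ?_
    rw [hca j hj]
    conv_lhs => rw [hdec j]
    module
  rw [hsum]
  have hI : ‖(RCLike.I : 𝕜)‖ ≤ 1 := by
    rcases eq_or_ne (RCLike.I : 𝕜) 0 with h0 | h0
    · simp [h0]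
    · exact (RCLike.norm_I_of_ne_zero h0).le
  have t1 := hunit _ fun j => hpos _ (hre j)
  have t2 := hunit _ fun j => hneg _ (hre j)
  have t3 := hunit _ fun j => hpos _ (him j)
  have t4 := hunit _ fun j => hneg _ (him j)
  refine (norm_add_le _ _).trans ?_
  rw [norm_smul]
  have n1 := norm_sub_le (∑ j ∈ A, ((((RCLike.re (c j))⁺ : ℝ) : 𝕜) * b j) • e j)
    (∑ j ∈ A, ((((RCLike.re (c j))⁻ : ℝ) : 𝕜) * b j) • e j)
  have n2 := norm_sub_le (∑ j ∈ A, ((((RCLike.im (c j))⁺ : ℝ) : 𝕜) * b j) • e j)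
    (∑ j ∈ A, ((((RCLike.im (c j))⁻ : ℝ) : 𝕜) * b j) • e j)
  have n3 := mul_le_mul_of_nonneg_right hI (norm_nonneg
    (∑ j ∈ A, ((((RCLike.im (c j))⁺ : ℝ) : 𝕜) * b j) • e j -
      ∑ j ∈ A, ((((RCLike.im (c j))⁻ : ℝ) : 𝕜) * b j) • e j))
  linarith

/-- Subsymmetry concerns increasing maps on all of `ℕ`, so partial ones must be extended: `φ`
enumerates `A`, `ψ` enumerates its image, and both continue beyond a common bound. -/
theorem exists_strictMono_extension (A : Finset ℕ) (π : ℕ → ℕ) (hπ : StrictMonoOn π A) :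
    ∃ φ ψ : ℕ → ℕ, StrictMono φ ∧ StrictMono ψ ∧
      (range A.card).image φ = A ∧ ∀ i < A.card, ψ i = π (φ i) := by
  let s := A.orderEmbOfFin rfl
  have hs : ∀ i, s i ∈ A := A.orderEmbOfFin_mem rfl
  let B := A.sup id + A.sup π + 1
  have hB1 : ∀ j ∈ A, j < B := fun j hj => by
    have := le_sup (f := id) hj
    simp only [B, id_eq] at *; omega
  have hB2 : ∀ j ∈ A, π j < B := fun j hj => by
    have := le_sup (f := π) hj
    simp only [B] at *; omega
  refine ⟨fun i => if h : i < A.card then s ⟨i, h⟩ else B + i,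
    fun i => if h : i < A.card then π (s ⟨i, h⟩) else B + i, ?_, ?_, ?_, ?_⟩
  · refine strictMono_nat_of_lt_succ fun i => ?_
    split_ifs with h1 h2 h2
    · exact s.strictMono (by simp [Fin.lt_def])
    · have := hB1 _ (hs ⟨i, h1⟩); omega
    · omega
    · omega
  · refine strictMono_nat_of_lt_succ fun i => ?_
    split_ifs with h1 h2 h2
    · exact hπ (hs _) (hs _) (s.strictMono (by simp [Fin.lt_def]))
    · have := hB2 _ (hs ⟨i, h1⟩); omega
    · omega
    · omega
  · ext j
    simp only [mem_image, mem_range]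
    constructor
    · rintro ⟨i, hi, rfl⟩
      rw [dif_pos hi]; exact hs _
    · intro hj
      have : j ∈ Set.range s := by rw [A.range_orderEmbOfFin rfl]; exact hj
      obtain ⟨i, rfl⟩ := this
      exact ⟨i, i.2, by rw [dif_pos i.2]⟩
  · intro i hi
    simp only [dif_pos hi]

theorem Subsymmetric.exists_spreading {e : SchauderBasis 𝕜 S} (he : Subsymmetric e) :
    ∃ K, Spreading e K := by
  obtain ⟨⟨U, hU⟩, hsub⟩ := he
  obtain ⟨C, hC, hφ⟩ := exists_uniform_subsequences (𝕜 := 𝕜) (fun j => e j) hsub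
  have hproj : ∀ (A : Finset ℕ) (f : S), ‖∑ j ∈ A, e.coord j f • e j‖ ≤ U * ‖f‖ := fun A f => by
    have := (GeneralSchauderBasis.proj e A).le_of_opNorm_le (hU A) f
    rwa [GeneralSchauderBasis.proj_apply] at this
  have hU0 : 0 ≤ U := (norm_nonneg _).trans (hU ∅)
  have hsubset : ∀ (A B : Finset ℕ) (a : ℕ → 𝕜), A ⊆ B →
      ‖∑ j ∈ A, a j • e j‖ ≤ U * ‖∑ j ∈ B, a j • e j‖ := fun A B a hAB => by
    have := hproj A (∑ j ∈ B, a j • e j)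
    rwa [sum_congr rfl fun j hj => by rw [coord_sum, if_pos (hAB hj)]] at this
  have hequiv : ∀ (A : Finset ℕ) (π : ℕ → ℕ) (a : ℕ → 𝕜), StrictMonoOn π A →
      ‖∑ j ∈ A, a j • e (π j)‖ ≤ C * C * ‖∑ j ∈ A, a j • e j‖ ∧
      ‖∑ j ∈ A, a j • e j‖ ≤ C * C * ‖∑ j ∈ A, a j • e (π j)‖ := fun A π a hπ => by
    -- The subsequences along `φ` and `ψ` are compared through `e` itself, hence the constant `C *
    -- C`.
    obtain ⟨φ, ψ, hφm, hψm, hA, hψφ⟩ := exists_strictMono_extension A π hπ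
    have e1 : ∑ j ∈ A, a j • e j = ∑ i ∈ range A.card, a (φ i) • e (φ i) := by
      conv_lhs => rw [← hA]
      rw [sum_image hφm.injective.injOn]
    have e2 : ∑ j ∈ A, a j • e (π j) = ∑ i ∈ range A.card, a (φ i) • e (ψ i) := by
      conv_lhs => rw [← hA]
      rw [sum_image hφm.injective.injOn]
      exact sum_congr rfl fun i hi => by rw [hψφ i (mem_range.1 hi)]
    rw [e1, e2]
    have h0 : 0 ≤ C := zero_le_one.trans hC
    exact ⟨((hφ ψ hψm).2.trans h0 (hφ φ hφm).1) _ (fun i => a (φ i)),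
      ((hφ φ hφm).2.trans h0 (hφ ψ hψm).1) _ (fun i => a (φ i))⟩
  have hCC : 0 ≤ C * C := by positivity
  refine ⟨1 + 4 * U + C * C, by linarith, fun A B a hAB => (hsubset A B a hAB).trans ?_,
    fun A f => (hproj A f).trans ?_,
    fun A a b hab => (norm_sum_mult_le hsubset A a b hab).trans ?_,
    fun A π a hπ => (hequiv A π a hπ).1.trans ?_, fun A π a hπ => (hequiv A π a hπ).2.trans ?_⟩
  all_goals
    gcongr
    linarith

end Subsymmetric

/-! ### Operators determined by their values on a basis. -/

section Operators

variable {𝕜 : Type*} [RCLike 𝕜] {S : Type*} [NormedAddCommGroup S] [NormedSpace 𝕜 S]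
  {Y : Type*} [NormedAddCommGroup Y] [NormedSpace 𝕜 Y]

theorem clm_ext_basis (e : SchauderBasis 𝕜 S) {T U : S →L[𝕜] Y} (h : ∀ k, T (e k) = U (e k)) :
    T = U := by
  ext f
  have h1 := ((T.continuous.tendsto f).comp (e.tendsto_proj f))
  have h2 := ((U.continuous.tendsto f).comp (e.tendsto_proj f))
  refine tendsto_nhds_unique h1 (h2.congr fun n => ?_)
  simp [h]

/-- Diagonal-type operators: a sequence dominated by a basis is its image under a bounded
operator. -/
theorem exists_clm_of_dominated [CompleteSpace S] [CompleteSpace Y] (e : SchauderBasis 𝕜 S)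
    {w : ℕ → Y} {C : ℝ} (h : Dominated 𝕜 C w e) : ∃ T : S →L[𝕜] Y, ∀ k, T (e k) = w k := by
  let T : ℕ → S →L[𝕜] Y := fun n => ∑ k ∈ range n, (e.coord k).smulRight (w k)
  have hT : ∀ n f, T n f = ∑ k ∈ range n, e.coord k f • w k := fun n f => by
    simp [T, _root_.sum_apply]
  have hcau : ∀ f, CauchySeq fun n => T n f := fun f => by
    -- The sign of `C` is not assumed, hence `|C|`.
    have h1 : CauchySeq fun n => ((|C| : ℝ) : 𝕜) • e.proj n f :=
      ((e.tendsto_proj f).const_smul ((|C| : ℝ) : 𝕜)).cauchySeq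
    rw [Metric.cauchySeq_iff'] at h1 ⊢
    intro ε hε
    obtain ⟨N, hN⟩ := h1 ε hε
    refine ⟨N, fun n hn => lt_of_le_of_lt ?_ (hN n hn)⟩
    rw [dist_eq_norm, dist_eq_norm, hT, hT, ← smul_sub, norm_smul,
      RCLike.norm_of_nonneg (abs_nonneg C), SchauderBasis.proj_apply, SchauderBasis.proj_apply, ← sum_Ico_eq_sub _ hn,
      ← sum_Ico_eq_sub _ hn]
    refine (h _ (fun k => e.coord k f)).trans ?_
    gcongr
    exact le_abs_self C
  choose g hg using fun f => cauchySeq_tendsto_of_complete (hcau f)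
  have hlim : Tendsto (fun n f => T n f) atTop (𝓝 g) := tendsto_pi_nhds.2 hg
  refine ⟨continuousLinearMapOfTendsto T hlim, fun k => ?_⟩
  refine tendsto_nhds_unique (hg (e k)) (tendsto_atTop_of_eventually_const (i₀ := k + 1) ?_)
  intro n hn
  rw [hT]
  rw [sum_eq_single k]
  · simp [e.ortho]
  · intro j _ hj
    simp [e.ortho, hj]
  · intro hk; exact absurd (mem_range.2 hn) hk

end Operators

/-! ### Averaging over interval partitions. -/

section Averaging

/-- A partition of `ℕ` into finite intervals: `lo k` and `len k` are the left end point and the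
length of the interval containing `k`. -/
structure IntervalPartition where
  lo : ℕ → ℕ
  len : ℕ → ℕ
  lo_le : ∀ k, lo k ≤ k
  lt_add : ∀ k, k < lo k + len k
  lo_eq : ∀ k l, lo k ≤ l → l < lo k + len k → lo l = lo k
  len_eq : ∀ k l, lo k ≤ l → l < lo k + len k → len l = len k

namespace IntervalPartition

variable (σ : IntervalPartition)

/-- The interval containing `k`. -/
def block (k : ℕ) : Finset ℕ := Ico (σ.lo k) (σ.lo k + σ.len k)

theorem mem_block {k l : ℕ} : l ∈ σ.block k ↔ σ.lo k ≤ l ∧ l < σ.lo k + σ.len k := mem_Ico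

theorem self_mem_block (k : ℕ) : k ∈ σ.block k := σ.mem_block.2 ⟨σ.lo_le k, σ.lt_add k⟩

theorem len_pos (k : ℕ) : 0 < σ.len k := by
  have := σ.lo_le k
  have := σ.lt_add k
  omega

theorem card_block (k : ℕ) : (σ.block k).card = σ.len k := by simp [block]

theorem block_eq {k l : ℕ} (h : l ∈ σ.block k) : σ.block l = σ.block k := by
  rw [mem_block] at h
  rw [block, block, σ.lo_eq k l h.1 h.2, σ.len_eq k l h.1 h.2]

theorem len_eq_of_mem {k l : ℕ} (h : l ∈ σ.block k) : σ.len l = σ.len k := by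
  rw [← card_block, ← card_block, σ.block_eq h]

theorem mem_block_comm {k l : ℕ} : l ∈ σ.block k ↔ k ∈ σ.block l :=
  ⟨fun h => σ.block_eq h ▸ σ.self_mem_block k, fun h => σ.block_eq h ▸ σ.self_mem_block l⟩

theorem add_len_le_lo {k l : ℕ} (hkl : k < l) (h : l ∉ σ.block k) :
    σ.lo k + σ.len k ≤ σ.lo l := by
  by_contra! hlt
  have h1 := σ.lo_le k
  have h2 := σ.lt_add k
  have h3 := σ.lo_le l
  have h4 := σ.lt_add l
  apply h
  rcases le_total (σ.lo k) (σ.lo l) with h5 | h5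
  · have h6 : σ.lo l ∈ σ.block k := σ.mem_block.2 ⟨h5, hlt⟩
    have h7 : σ.lo l ∈ σ.block l := σ.mem_block.2 ⟨le_rfl, by omega⟩
    rw [← σ.block_eq h6, σ.block_eq h7]
    exact σ.self_mem_block l
  · rw [σ.mem_block_comm, σ.mem_block]
    omega

/-- Simultaneous cyclic shift of all the intervals of a partition. -/
def shift (s k : ℕ) : ℕ := σ.lo k + (k - σ.lo k + s) % σ.len k

theorem shift_mem (s k : ℕ) : σ.shift s k ∈ σ.block k := by
  rw [mem_block, shift]
  have := Nat.mod_lt (k - σ.lo k + s) (σ.len_pos k)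
  omega

theorem shift_of_lt {s k : ℕ} (h : k - σ.lo k + s % σ.len k < σ.len k) :
    σ.shift s k = k + s % σ.len k := by
  have h1 := σ.lo_le k
  rw [shift, Nat.add_mod, Nat.mod_eq_of_lt (a := k - σ.lo k) (by omega), Nat.mod_eq_of_lt h]
  omega

theorem shift_of_le {s k : ℕ} (h : σ.len k ≤ k - σ.lo k + s % σ.len k) :
    σ.shift s k + σ.len k = k + s % σ.len k := by
  have h1 := σ.lo_le k
  have h2 := σ.lt_add k
  have h3 := Nat.mod_lt s (σ.len_pos k)
  rw [shift, Nat.add_mod, Nat.mod_eq_of_lt (a := k - σ.lo k) (by omega),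
    Nat.mod_eq_sub_mod h, Nat.mod_eq_of_lt (by omega)]
  omega

/-- These are the points that do not wrap around: inside an interval they all move by the same
amount, and no shift leaves its interval. -/
theorem strictMonoOn_shift_of_lt (s : ℕ) :
    StrictMonoOn (σ.shift s) {k | k - σ.lo k + s % σ.len k < σ.len k} := by
  intro k hk l hl hkl
  by_cases h : l ∈ σ.block k
  · rw [σ.shift_of_lt hk, σ.shift_of_lt hl, σ.len_eq_of_mem h]
    omega
  · have h1 := σ.add_len_le_lo hkl h
    have h2 := σ.mem_block.1 (σ.shift_mem s k)
    have h3 := σ.mem_block.1 (σ.shift_mem s l)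
    omega

theorem strictMonoOn_shift_of_le (s : ℕ) :
    StrictMonoOn (σ.shift s) {k | σ.len k ≤ k - σ.lo k + s % σ.len k} := by
  intro k hk l hl hkl
  by_cases h : l ∈ σ.block k
  · have h1 := σ.shift_of_le hk
    have h2 := σ.shift_of_le hl
    rw [σ.len_eq_of_mem h] at h2
    omega
  · have h1 := σ.add_len_le_lo hkl h
    have h2 := σ.mem_block.1 (σ.shift_mem s k)
    have h3 := σ.mem_block.1 (σ.shift_mem s l)
    omega

/-- As `s` runs through `q` full periods, the shifts of `k` visit every point of its interval `q`
times. -/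
theorem sum_shift {M : Type*} [AddCommMonoid M] (f : ℕ → M) (k q : ℕ) :
    ∑ s ∈ range (σ.len k * q), f (σ.shift s k) = q • ∑ l ∈ σ.block k, f l := by
  have hper : ∀ n, ∑ s ∈ Ico n (n + σ.len k), f (σ.lo k + s % σ.len k) = ∑ l ∈ σ.block k, f l := by
    intro n
    have := congrArg (fun m => (m.map fun i => f (σ.lo k + i)).sum)
      (Nat.multiset_Ico_map_mod n (σ.len k))
    simp only [Multiset.map_map, Function.comp_def] at this
    rw [block, sum_Ico_eq_sum_range _ (σ.lo k), add_tsub_cancel_left]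
    exact this
  induction q with
  | zero => simp
  | succ q ih =>
    rw [mul_add, mul_one, sum_range_add, ih, succ_nsmul]
    congr 1
    rw [← hper (k - σ.lo k + σ.len k * q), sum_Ico_eq_sum_range, add_tsub_cancel_left]
    simp only [shift, add_assoc]

end IntervalPartition

variable {𝕜 : Type*} [RCLike 𝕜] {S : Type*} [NormedAddCommGroup S] [NormedSpace 𝕜 S]
  {e : SchauderBasis 𝕜 S} {K : ℝ}

namespace Spreading

/-- A cyclic shift is increasing on the indices that wrap around and on those that do not; each of
the two pieces costs `K ^ 2`. -/
theorem norm_sum_shift_le (hK : Spreading e K) (σ : IntervalPartition) (s : ℕ) (F : Finset ℕ)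
    (a : ℕ → 𝕜) : ‖∑ k ∈ F, a k • e (σ.shift s k)‖ ≤ 2 * K ^ 2 * ‖∑ k ∈ F, a k • e k‖ := by
  have h0 : 0 ≤ K := zero_le_one.trans hK.one_le
  rw [← sum_filter_add_sum_filter_not F fun k => k - σ.lo k + s % σ.len k < σ.len k]
  refine (norm_add_le _ _).trans ?_
  have h1 : ∀ G ⊆ F, StrictMonoOn (σ.shift s) G →
      ‖∑ k ∈ G, a k • e (σ.shift s k)‖ ≤ K ^ 2 * ‖∑ k ∈ F, a k • e k‖ := fun G hG hmono =>
    calc _ ≤ K * ‖∑ k ∈ G, a k • e k‖ := hK.spread _ _ _ hmono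
      _ ≤ K * (K * ‖∑ k ∈ F, a k • e k‖) := by gcongr; exact hK.subset _ _ _ hG
      _ = _ := by ring
  have h2 := h1 _ (filter_subset (fun k => k - σ.lo k + s % σ.len k < σ.len k) F)
    ((σ.strictMonoOn_shift_of_lt s).mono fun k hk => (mem_filter.1 hk).2)
  have h3 := h1 _ (filter_subset (fun k => ¬ k - σ.lo k + s % σ.len k < σ.len k) F)
    ((σ.strictMonoOn_shift_of_le s).mono fun k hk => not_lt.1 (mem_filter.1 hk).2)
  linarith

/-- The averaging operator is a mean of cyclic shifts, which are uniformly bounded. -/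
theorem dominated_average (hK : Spreading e K) (σ : IntervalPartition) :
    Dominated 𝕜 (2 * K ^ 2) (fun k => (σ.len k : 𝕜)⁻¹ • ∑ l ∈ σ.block k, e l) e := by
  intro F a
  -- A common multiple of the finitely many lengths involved, so that the same `M` shifts average
  -- every interval.
  let M := ∏ k ∈ F, σ.len k
  have hM : 0 < M := prod_pos fun k _ => σ.len_pos k
  have hM' : (M : 𝕜) ≠ 0 := by exact_mod_cast hM.ne'
  have heq : (M : 𝕜) • ∑ k ∈ F, a k • (σ.len k : 𝕜)⁻¹ • ∑ l ∈ σ.block k, e l =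
      ∑ s ∈ range M, ∑ k ∈ F, a k • e (σ.shift s k) := by
    rw [sum_comm, smul_sum]
    refine sum_congr rfl fun k hk => ?_
    obtain ⟨q, hq⟩ : σ.len k ∣ M := dvd_prod_of_mem _ hk
    have hlen : (σ.len k : 𝕜) ≠ 0 := by exact_mod_cast (σ.len_pos k).ne'
    rw [← smul_sum, hq, σ.sum_shift (fun l => e l), smul_comm, ← Nat.cast_smul_eq_nsmul 𝕜 q]
    simp only [smul_smul]
    congr 1
    push_cast
    field_simp
  have hle : ‖(M : 𝕜) • ∑ k ∈ F, a k • (σ.len k : 𝕜)⁻¹ • ∑ l ∈ σ.block k, e l‖ ≤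
      M * (2 * K ^ 2 * ‖∑ k ∈ F, a k • e k‖) := by
    rw [heq]
    refine (norm_sum_le _ _).trans ((sum_le_sum fun s _ => hK.norm_sum_shift_le σ s F a).trans ?_)
    simp
  rw [norm_smul, RCLike.norm_natCast] at hle
  exact le_of_mul_le_mul_left hle (by exact_mod_cast hM)

end Spreading

theorem exists_average [CompleteSpace S] (hK : Spreading e K) (σ : IntervalPartition) :
    ∃ P : S →L[𝕜] S, ∀ k, P (e k) = (σ.len k : 𝕜)⁻¹ • ∑ l ∈ σ.block k, e l :=
  exists_clm_of_dominated e (hK.dominated_average σ)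

end Averaging

/-! ### The fundamental function of a subsymmetric basis. -/

section Fundamental

variable {𝕜 : Type*} [RCLike 𝕜] {S : Type*} [NormedAddCommGroup S] [NormedSpace 𝕜 S]

/-- The norm of the sum of the first `m` vectors of a basis. -/
def sumNorm (e : SchauderBasis 𝕜 S) (m : ℕ) : ℝ := ‖∑ j ∈ range m, e j‖

variable {e : SchauderBasis 𝕜 S} {K : ℝ}

theorem sumNorm_nonneg (e : SchauderBasis 𝕜 S) (m : ℕ) : 0 ≤ sumNorm e m := norm_nonneg _

theorem sumNorm_pos (e : SchauderBasis 𝕜 S) {m : ℕ} (hm : 0 < m) : 0 < sumNorm e m := by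
  rw [sumNorm, norm_pos_iff]
  intro h
  have := coord_sum e (range m) (fun _ => 1) 0
  simp [h, hm] at this

/-- The partition into intervals of constant length. -/
def constPartition (m : ℕ) (hm : 0 < m) : IntervalPartition where
  lo k := m * (k / m)
  len _ := m
  lo_le k := Nat.mul_div_le k m
  lt_add k := by
    have := Nat.div_add_mod k m
    have := Nat.mod_lt k hm
    omega
  lo_eq k l h1 h2 := by
    congr 1
    rw [Nat.div_eq_iff hm]
    rw [mul_comm] at h1 h2; omega
  len_eq _ _ _ _ := rfl

namespace Spreading

theorem pos (hK : Spreading e K) : 0 < K := zero_lt_one.trans_le hK.one_le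

theorem compare_range (hK : Spreading e K) (A : Finset ℕ) (a : ℕ → 𝕜) :
    ∃ φ : ℕ → ℕ, (range A.card).image φ = A ∧ StrictMono φ ∧
      ‖∑ i ∈ range A.card, a (φ i) • e i‖ ≤ K * ‖∑ j ∈ A, a j • e j‖ ∧
      ‖∑ j ∈ A, a j • e j‖ ≤ K * ‖∑ i ∈ range A.card, a (φ i) • e i‖ := by
  obtain ⟨φ, -, hφ, -, hA, -⟩ := exists_strictMono_extension A id (strictMono_id.strictMonoOn _)
  have h1 : ∑ j ∈ A, a j • e j = ∑ i ∈ range A.card, a (φ i) • e (φ i) := by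
    conv_lhs => rw [← hA]
    rw [sum_image hφ.injective.injOn]
  refine ⟨φ, hA, hφ, ?_, ?_⟩ <;> rw [h1]
  · exact hK.unspread _ _ (fun i => a (φ i)) (hφ.strictMonoOn _)
  · exact hK.spread _ _ (fun i => a (φ i)) (hφ.strictMonoOn _)

theorem norm_sum_le_sumNorm (hK : Spreading e K) (A : Finset ℕ) :
    ‖∑ j ∈ A, e j‖ ≤ K * sumNorm e A.card := by
  obtain ⟨φ, -, -, -, h⟩ := hK.compare_range A (fun _ => 1)
  simpa using! h

theorem sumNorm_le_norm_sum (hK : Spreading e K) (A : Finset ℕ) :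
    sumNorm e A.card ≤ K * ‖∑ j ∈ A, e j‖ := by
  obtain ⟨φ, -, -, h, -⟩ := hK.compare_range A (fun _ => 1)
  simpa using! h

theorem sumNorm_mono (hK : Spreading e K) {m n : ℕ} (h : m ≤ n) :
    sumNorm e m ≤ K * sumNorm e n := by
  simpa using! hK.subset (range m) (range n) (fun _ => 1) (range_mono h)

theorem norm_sum_le_of_le (hK : Spreading e K) {A : Finset ℕ} {a : ℕ → 𝕜} {t : ℝ}
    (h : ∀ j ∈ A, ‖a j‖ ≤ t) (ht : 0 ≤ t) :
    ‖∑ j ∈ A, a j • e j‖ ≤ K ^ 2 * (t * sumNorm e A.card) := by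
  have h1 := hK.mult A a (fun _ => (t : 𝕜)) fun j hj => by
    rw [RCLike.norm_of_nonneg ht]; exact h j hj
  rw [← smul_sum, norm_smul, RCLike.norm_of_nonneg ht] at h1
  calc _ ≤ K * (t * ‖∑ j ∈ A, e j‖) := h1
    _ ≤ K * (t * (K * sumNorm e A.card)) := by
      have := hK.pos; gcongr; exact hK.norm_sum_le_sumNorm A
    _ = _ := by ring

theorem le_norm_sum_of_le (hK : Spreading e K) {A : Finset ℕ} {a : ℕ → 𝕜} {t : ℝ}
    (h : ∀ j ∈ A, t ≤ ‖a j‖) (ht : 0 ≤ t) :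
    t * sumNorm e A.card ≤ K ^ 2 * ‖∑ j ∈ A, a j • e j‖ := by
  have h1 := hK.mult A (fun _ => (t : 𝕜)) a fun j hj => by
    rw [RCLike.norm_of_nonneg ht]; exact h j hj
  rw [← smul_sum, norm_smul, RCLike.norm_of_nonneg ht] at h1
  calc _ ≤ t * (K * ‖∑ j ∈ A, e j‖) := by gcongr; exact hK.sumNorm_le_norm_sum A
    _ = K * (t * ‖∑ j ∈ A, e j‖) := by ring
    _ ≤ K * (K * ‖∑ j ∈ A, a j • e j‖) := by have := hK.pos; gcongr
    _ = _ := by ring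

/-- The first interval of the partition into intervals of length `m` is `range m`, so averaging
replaces the coefficients by their mean. -/
theorem average_range (hK : Spreading e K) (m : ℕ) (a : ℕ → 𝕜) :
    ‖∑ i ∈ range m, a i‖ * sumNorm e m ≤ 2 * K ^ 2 * (m * ‖∑ i ∈ range m, a i • e i‖) := by
  rcases Nat.eq_zero_or_pos m with rfl | hm
  · simp
  have hm' : (0 : ℝ) < m := by exact_mod_cast hm
  have h := hK.dominated_average (constPartition m hm) (range m) a
  have hb : ∀ k ∈ range m, (constPartition m hm).block k = range m := fun k hk => by
    rw [mem_range] at hk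
    simp [IntervalPartition.block, constPartition, Nat.div_eq_of_lt hk]
  have h' : ∑ k ∈ range m, a k • ((constPartition m hm).len k : 𝕜)⁻¹ •
      ∑ l ∈ (constPartition m hm).block k, e l =
      ∑ k ∈ range m, a k • (m : 𝕜)⁻¹ • ∑ l ∈ range m, e l :=
    sum_congr rfl fun k hk => by rw [hb k hk]; rfl
  rw [h', ← sum_smul] at h
  rw [smul_smul, norm_smul, norm_mul, norm_inv, RCLike.norm_natCast] at h
  calc _ = m * (‖∑ i ∈ range m, a i‖ * (m : ℝ)⁻¹ * ‖∑ i ∈ range m, e i‖) := by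
        rw [sumNorm]; field_simp
    _ ≤ m * (2 * K ^ 2 * ‖∑ i ∈ range m, a i • e i‖) := by gcongr
    _ = _ := by ring

/-- Averaging over an arbitrary finite set. -/
theorem sum_norm_le (hK : Spreading e K) (A : Finset ℕ) (a : ℕ → 𝕜) :
    (∑ j ∈ A, ‖a j‖) * sumNorm e A.card ≤ 2 * K ^ 4 * (A.card * ‖∑ j ∈ A, a j • e j‖) := by
  obtain ⟨φ, hA, hφ, h, -⟩ := hK.compare_range A (fun j => (‖a j‖ : 𝕜))
  have h1 : ∑ j ∈ A, ‖a j‖ = ‖∑ i ∈ range A.card, ((‖a (φ i)‖ : ℝ) : 𝕜)‖ := by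
    rw [← RCLike.ofReal_sum, RCLike.norm_of_nonneg (sum_nonneg fun _ _ => norm_nonneg _)]
    conv_lhs => rw [← hA]
    rw [sum_image hφ.injective.injOn]
  have h2 := hK.mult A (fun j => (‖a j‖ : 𝕜)) a fun j _ => by simp
  have h0 := hK.pos
  rw [h1]
  calc _ ≤ 2 * K ^ 2 * (A.card * ‖∑ i ∈ range A.card, ((‖a (φ i)‖ : ℝ) : 𝕜) • e i‖) :=
        hK.average_range _ _
    _ ≤ 2 * K ^ 2 * (A.card * (K * (K * ‖∑ j ∈ A, a j • e j‖))) := by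
        gcongr
        exact h.trans (by gcongr)
    _ = _ := by ring

/-- Up to a constant, `sumNorm e n / n` is nonincreasing: average the indicator of the first `m`
indices over the first `n`. -/
theorem sumNorm_mul_le (hK : Spreading e K) {m n : ℕ} (h : m ≤ n) :
    sumNorm e n * m ≤ 2 * K ^ 2 * (n * sumNorm e m) := by
  have h1 := hK.average_range n (fun i => if i < m then 1 else 0)
  have h2 : (range n).filter (· < m) = range m := by
    ext i; simp; omega
  simp only [ite_smul, one_smul, zero_smul, ← sum_filter, h2, sum_const, card_range,
    nsmul_eq_mul, mul_one, RCLike.norm_natCast] at h1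
  rw [mul_comm]
  exact h1

theorem sumNorm_two_mul (hK : Spreading e K) (m : ℕ) :
    sumNorm e (2 * m) ≤ 4 * K ^ 2 * sumNorm e m := by
  rcases Nat.eq_zero_or_pos m with rfl | hm
  · simp [sumNorm]
  have h := hK.sumNorm_mul_le (show m ≤ 2 * m by omega)
  have hm' : (0 : ℝ) < m := by exact_mod_cast hm
  refine le_of_mul_le_mul_right (h.trans_eq ?_) hm'
  push_cast; ring

end Spreading

end Fundamental

/-! ### Lower regularity from nontrivial type. -/

section LowerRegularity

theorem HasType.exists_bound {X : Type*} [NormedAddCommGroup X] {p : ℝ} (hp : 0 < p)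
    (h : HasType X p) : ∃ T : ℝ, 0 < T ∧ ∀ (n : ℕ) (x : Fin n → X) (c d : ℝ), 0 ≤ c → 0 ≤ d →
      (∀ ε : Fin n → ℤˣ, c ≤ ‖∑ i, (ε i : ℤ) • x i‖) → (∀ i, ‖x i‖ ≤ d) →
      c ≤ T * ((n : ℝ) ^ (1 / p) * d) := by
  obtain ⟨T, hT⟩ := h
  refine ⟨|T| + 1, by positivity, fun n x c d hc hd hε hx => ?_⟩
  have h1 : c ≤ ((∑ ε : Fin n → ℤˣ, ‖∑ i, (ε i : ℤ) • x i‖ ^ p) / 2 ^ n) ^ (1 / p) := by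
    have h2 : c ^ p ≤ (∑ ε : Fin n → ℤˣ, ‖∑ i, (ε i : ℤ) • x i‖ ^ p) / 2 ^ n := by
      rw [le_div_iff₀ (by positivity)]
      calc c ^ p * 2 ^ n = ∑ _ε : Fin n → ℤˣ, c ^ p := by simp [mul_comm]
        _ ≤ _ := sum_le_sum fun ε _ => Real.rpow_le_rpow hc (hε ε) hp.le
    calc c = (c ^ p) ^ (1 / p) := by rw [← Real.rpow_mul hc, mul_one_div_cancel hp.ne',
            Real.rpow_one]
      _ ≤ _ := Real.rpow_le_rpow (by positivity) h2 (by positivity)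
  have h3 : (∑ i, ‖x i‖ ^ p) ^ (1 / p) ≤ (n : ℝ) ^ (1 / p) * d := by
    have h4 : ∑ i, ‖x i‖ ^ p ≤ n * d ^ p := by
      calc ∑ i, ‖x i‖ ^ p ≤ ∑ _i : Fin n, d ^ p :=
            sum_le_sum fun i _ => Real.rpow_le_rpow (norm_nonneg _) (hx i) hp.le
        _ = _ := by simp
    calc _ ≤ (n * d ^ p) ^ (1 / p) :=
          Real.rpow_le_rpow (sum_nonneg fun _ _ => by positivity) h4 (by positivity)
      _ = _ := by
          rw [Real.mul_rpow (by positivity) (by positivity), ← Real.rpow_mul hd,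
            mul_one_div_cancel hp.ne', Real.rpow_one]
  have h5 : 0 ≤ (∑ i, ‖x i‖ ^ p) ^ (1 / p) :=
    Real.rpow_nonneg (sum_nonneg fun _ _ => by positivity) _
  calc c ≤ T * (∑ i, ‖x i‖ ^ p) ^ (1 / p) := h1.trans (hT n x)
    _ ≤ (|T| + 1) * (∑ i, ‖x i‖ ^ p) ^ (1 / p) := by
        gcongr; linarith [le_abs_self T]
    _ ≤ _ := by gcongr

variable {𝕜 : Type*} [RCLike 𝕜] {S : Type*} [NormedAddCommGroup S] [NormedSpace 𝕜 S]
  {e : SchauderBasis 𝕜 S} {K : ℝ}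

/-- Take `2 ^ k` consecutive intervals of length `m`, one for each sign pattern, and let `x j` carry
the `j`-th sign of the pattern. Whatever the signs `ε`, the sum `∑ ε j • x j` has coefficient `k` on
the interval of pattern `ε`, whereas every `x j` has norm at most a multiple of `sumNorm e (2 ^ k *
m)`. Type `p` compares the two. -/
theorem Spreading.mul_sumNorm_le (hK : Spreading e K) {p : ℝ} (hp : 0 < p) (h : HasType S p) :
    ∃ T : ℝ, 0 < T ∧ ∀ k m : ℕ, 0 < m →
      k * sumNorm e m ≤ T * ((k : ℝ) ^ (1 / p) * sumNorm e (2 ^ k * m)) := by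
  obtain ⟨T, hT, hbound⟩ := h.exists_bound hp
  have h0 := hK.pos
  refine ⟨K ^ 5 * T, by positivity, fun k m hm => ?_⟩
  have hcard : Fintype.card (Fin k → ℤˣ) = 2 ^ k := by simp
  let ι := Fintype.equivFinOfCardEq hcard
  -- The sign pattern of the `i`-th interval; the default value is never met below `2 ^ k * m`.
  let δ : ℕ → Fin k → ℤˣ := fun i => if h : i < 2 ^ k then ι.symm ⟨i, h⟩ else 1
  let x : Fin k → S := fun j => ∑ i ∈ range (2 ^ k * m), (((δ (i / m) j : ℤˣ) : ℤ) : 𝕜) • e i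
  have hunit : ∀ u : ℤˣ, ‖((u : ℤ) : 𝕜)‖ ≤ 1 := fun u => by
    rcases Int.units_eq_one_or u with rfl | rfl <;> simp
  have hx : ∀ j, ‖x j‖ ≤ K ^ 2 * sumNorm e (2 ^ k * m) := fun j => by
    simpa using hK.norm_sum_le_of_le (A := range (2 ^ k * m)) (t := 1)
      (a := fun i => (((δ (i / m) j : ℤˣ) : ℤ) : 𝕜)) (fun i _ => hunit _) zero_le_one
  have hε : ∀ ε : Fin k → ℤˣ, (K ^ 3)⁻¹ * (k * sumNorm e m) ≤ ‖∑ j, (ε j : ℤ) • x j‖ := by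
    intro ε
    have hsum : ∑ j, (ε j : ℤ) • x j = ∑ i ∈ range (2 ^ k * m),
        (∑ j, ((ε j : ℤ) : 𝕜) * ((δ (i / m) j : ℤ) : 𝕜)) • e i := by
      simp only [x, smul_sum, sum_smul]
      rw [sum_comm]
      refine sum_congr rfl fun i _ => sum_congr rfl fun j _ => ?_
      rw [← Int.cast_smul_eq_zsmul 𝕜, smul_smul]
    let i₀ : ℕ := ι ε
    have hi₀ : i₀ < 2 ^ k := (ι ε).2
    let A : Finset ℕ := Ico (i₀ * m) (i₀ * m + m)
    have hA : A ⊆ range (2 ^ k * m) := fun i hi => by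
      simp only [A, mem_Ico] at hi
      rw [mem_range]
      have : (i₀ + 1) * m ≤ 2 ^ k * m := Nat.mul_le_mul_right m hi₀
      linarith
    have hδ : ∀ i ∈ A, δ (i / m) = ε := fun i hi => by
      simp only [A, mem_Ico] at hi
      have : i / m = i₀ := by rw [Nat.div_eq_iff hm]; omega
      rw [this]
      simp [δ, hi₀, i₀]
    have hcoef : ∀ i ∈ A, (k : ℝ) ≤ ‖∑ j, ((ε j : ℤ) : 𝕜) * ((δ (i / m) j : ℤ) : 𝕜)‖ := by
      intro i hi
      rw [hδ i hi]
      have : ∀ j, ((ε j : ℤ) : 𝕜) * ((ε j : ℤ) : 𝕜) = 1 := fun j => by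
        rcases Int.units_eq_one_or (ε j) with h | h <;> simp [h]
      simp [this]
    have h1 := hK.le_norm_sum_of_le hcoef (Nat.cast_nonneg k)
    have h2 := hK.subset A _ (fun i => ∑ j, ((ε j : ℤ) : 𝕜) * ((δ (i / m) j : ℤ) : 𝕜)) hA
    have hAc : A.card = m := by simp [A]
    rw [hAc] at h1
    rw [hsum, inv_mul_le_iff₀ (by positivity)]
    refine h1.trans ((mul_le_mul_of_nonneg_left h2 (by positivity)).trans_eq ?_)
    ring
  have h1 := hbound k x _ _ (by have := sumNorm_nonneg e m; positivity)
    (by have := sumNorm_nonneg e (2 ^ k * m); positivity) hε hx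
  rw [inv_mul_le_iff₀ (by positivity)] at h1
  refine h1.trans_eq ?_
  ring

/-- Peel off the last `R` terms: each is at most `K * u r`, and the remaining sum is bounded through
`u (r - R)`, where doubling gains a factor 2. -/
theorem sum_le_of_doubling {u : ℕ → ℝ} {K : ℝ} (hu : ∀ n, 0 ≤ u n) {R : ℕ}
    (hR : 0 < R) (hmono : ∀ m n, m ≤ n → u m ≤ K * u n) (hdouble : ∀ n, 2 * u n ≤ u (n + R))
    (hK : 0 ≤ K) (r : ℕ) : ∑ n ∈ range r, u n ≤ 2 * R * K * u r := by
  induction r using Nat.strong_induction_on with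
  | _ r ih =>
    have hKu := mul_nonneg hK (hu r)
    have hsum : ∀ A : Finset ℕ, (∀ n ∈ A, n ≤ r) → A.card ≤ R → ∑ n ∈ A, u n ≤ R * K * u r := by
      intro A hA hcard
      calc ∑ n ∈ A, u n ≤ ∑ _n ∈ A, K * u r := sum_le_sum fun n hn => hmono n r (hA n hn)
        _ = A.card * (K * u r) := by simp
        _ ≤ R * (K * u r) := by gcongr
        _ = _ := by ring
    rcases lt_or_ge r R with h | h
    · have := hsum (range r) (fun n hn => (mem_range.1 hn).le) (by simpa using h.le)
      nlinarith
    · obtain ⟨q, rfl⟩ := Nat.exists_eq_add_of_le' h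
      have h1 := ih q (by omega)
      have h2 := hsum (Ico q (q + R)) (fun n hn => (mem_Ico.1 hn).2.le) (by simp)
      rw [← sum_range_add_sum_Ico u (show q ≤ q + R by omega)]
      have h3 := mul_le_mul_of_nonneg_left (hdouble q) (show 0 ≤ R * K by positivity)
      linarith

/-- Lower regularity of the fundamental function in spaces of nontrivial type. -/
theorem Spreading.sum_sumNorm_le (hK : Spreading e K) (h : HasNontrivialType S) :
    ∃ C : ℝ, 0 < C ∧
      ∀ r : ℕ, ∑ n ∈ range (r + 1), sumNorm e (2 ^ n) ≤ C * sumNorm e (2 ^ r) := by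
  obtain ⟨p, hp, -, hpt⟩ := h
  have hp0 : 0 < p := by linarith
  have h0 := hK.pos
  obtain ⟨T, hT, hk⟩ := hK.mul_sumNorm_le hp0 hpt
  have hs : 0 < 1 - 1 / p := by
    rw [sub_pos, div_lt_one hp0]; exact hp
  -- As `p > 1`, the factor `R ^ (1 - 1 / p)` eventually exceeds `2 * T`. If `R` dyadic steps failed
  -- to double `sumNorm`, this would contradict the type estimate with `k = R`.
  obtain ⟨R, hR1, hR2⟩ := (((tendsto_rpow_atTop hs).comp
    (tendsto_natCast_atTop_atTop (R := ℝ))).eventually_gt_atTop (2 * T)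
    |>.and (eventually_ge_atTop 1)).exists
  have hRpos : (0 : ℝ) < R := by exact_mod_cast hR2
  simp only [Function.comp_apply] at hR1
  have hdouble : ∀ n, 2 * sumNorm e (2 ^ n) ≤ sumNorm e (2 ^ (n + R)) := by
    intro n
    by_contra! hlt
    have h1 := hk R (2 ^ n) (by positivity)
    rw [← pow_add, add_comm R n] at h1
    have hpos : 0 < sumNorm e (2 ^ n) := sumNorm_pos e (by positivity)
    have h2 : R * sumNorm e (2 ^ n) < T * ((R : ℝ) ^ (1 / p) * (2 * sumNorm e (2 ^ n))) :=
      h1.trans_lt (by gcongr)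
    have h3 : (R : ℝ) < 2 * T * (R : ℝ) ^ (1 / p) :=
      lt_of_mul_lt_mul_right (h2.trans_eq (by ring)) hpos.le
    have h4 : (R : ℝ) = (R : ℝ) ^ (1 - 1 / p) * (R : ℝ) ^ (1 / p) := by
      rw [← Real.rpow_add hRpos]; simp
    have h5 : 2 * T * (R : ℝ) ^ (1 / p) < (R : ℝ) ^ (1 - 1 / p) * (R : ℝ) ^ (1 / p) := by
      gcongr
    linarith
  refine ⟨2 * R * K + 1, by positivity, fun r => ?_⟩
  have := sum_le_of_doubling (u := fun n => sumNorm e (2 ^ n)) (fun n => sumNorm_nonneg _ _)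
    hR2 (fun m n hmn => hK.sumNorm_mono (Nat.pow_le_pow_right two_pos hmn)) hdouble h0.le r
  rw [sum_range_succ]
  linarith

end LowerRegularity

/-! ### The dyadic partition and a self-similar refinement. -/

section Partitions

theorem log_two_eq_iff {n r : ℕ} (hn : n ≠ 0) :
    Nat.log 2 n = r ↔ 2 ^ r ≤ n ∧ n < 2 ^ (r + 1) :=
  Nat.log_eq_iff (Or.inr ⟨one_lt_two, hn⟩)

/-- The index of the dyadic interval `[2 ^ n - 1, 2 ^ (n + 1) - 1)` containing `k`. -/
def level (k : ℕ) : ℕ := Nat.log 2 (k + 1)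

theorem level_eq_iff {k n : ℕ} : level k = n ↔ 2 ^ n ≤ k + 1 ∧ k + 1 < 2 ^ (n + 1) :=
  log_two_eq_iff (Nat.succ_ne_zero k)

theorem level_spec (k : ℕ) : 2 ^ level k ≤ k + 1 ∧ k + 1 < 2 ^ (level k + 1) :=
  level_eq_iff.1 rfl

theorem level_mono : Monotone level := fun _ _ h => Nat.log_mono_right (by omega)

/-- The partition of `ℕ` into the intervals `[2 ^ n - 1, 2 ^ (n + 1) - 1)`. -/
def dyadic : IntervalPartition where
  lo k := 2 ^ level k - 1
  len k := 2 ^ level k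
  lo_le k := by have := level_spec k; omega
  lt_add k := by have := level_spec k; rw [pow_succ] at this; omega
  lo_eq k l h1 h2 := by
    have : level l = level k := by
      have h3 : 0 < 2 ^ level k := by positivity
      rw [level_eq_iff, pow_succ]
      omega
    rw [this]
  len_eq k l h1 h2 := by
    have : level l = level k := by
      have h3 : 0 < 2 ^ level k := by positivity
      rw [level_eq_iff, pow_succ]
      omega
    rw [this]

theorem mem_dyadic_block {k l : ℕ} : l ∈ dyadic.block k ↔ level l = level k := by
  have h3 : 0 < 2 ^ level k := by positivity
  rw [IntervalPartition.mem_block, level_eq_iff, pow_succ]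
  simp only [dyadic]
  omega

/-- The position of `k` in its dyadic interval. -/
def offset (k : ℕ) : ℕ := k + 1 - 2 ^ level k

theorem offset_add (k : ℕ) : 2 ^ level k + offset k = k + 1 := by
  have := level_spec k
  rw [offset]; omega

theorem offset_lt (k : ℕ) : offset k < 2 ^ level k := by
  have := level_spec k
  rw [pow_succ] at this
  rw [offset]; omega

theorem level_offset_of_eq {k r i : ℕ} (h : k + 1 = 2 ^ r + i) (hi : i < 2 ^ r) :
    level k = r ∧ offset k = i := by
  have h1 : level k = r := by rw [level_eq_iff, pow_succ]; omega
  exact ⟨h1, by rw [offset, h1]; omega⟩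

theorem log_offset_lt {k : ℕ} (h : offset k ≠ 0) : Nat.log 2 (offset k) < level k := by
  have h1 := Nat.pow_log_le_self 2 h
  exact (Nat.pow_lt_pow_iff_right one_lt_two).1 (h1.trans_lt (offset_lt k))

/-- The nested interval of `k` stays in the level of `k`, because `Nat.log 2 (offset k)` is strictly
below the level. Hence level and logarithm of the offset are constant on it. -/
theorem nestedDyadic_aux {k l : ℕ} (h : offset k ≠ 0)
    (h1 : 2 ^ level k + 2 ^ Nat.log 2 (offset k) ≤ l + 1)
    (h2 : l + 1 < 2 ^ level k + 2 ^ Nat.log 2 (offset k) + 2 ^ Nat.log 2 (offset k)) :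
    level l = level k ∧ offset l ≠ 0 ∧ Nat.log 2 (offset l) = Nat.log 2 (offset k) := by
  have h3 : 2 ^ (Nat.log 2 (offset k) + 1) ≤ 2 ^ level k :=
    Nat.pow_le_pow_right two_pos (log_offset_lt h)
  have h4 : 0 < 2 ^ Nat.log 2 (offset k) := by positivity
  rw [pow_succ] at h3
  obtain ⟨h5, h6⟩ := level_offset_of_eq (k := l) (r := level k) (i := l + 1 - 2 ^ level k)
    (by omega) (by omega)
  refine ⟨h5, by omega, ?_⟩
  rw [log_two_eq_iff (by omega), pow_succ]
  omega

/-- The partition of `ℕ` obtained by subdividing every dyadic interval into a point and dyadic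
intervals of all smaller lengths. -/
def nestedDyadic : IntervalPartition where
  lo k := if offset k = 0 then k else 2 ^ level k + 2 ^ Nat.log 2 (offset k) - 1
  len k := if offset k = 0 then 1 else 2 ^ Nat.log 2 (offset k)
  lo_le k := by
    split_ifs with h
    · exact le_rfl
    · have := offset_add k
      have := Nat.pow_log_le_self 2 h
      omega
  lt_add k := by
    split_ifs with h
    · omega
    · have := offset_add k
      have := Nat.lt_pow_succ_log_self one_lt_two (offset k)
      rw [pow_succ] at this
      omega
  lo_eq k l h1 h2 := by
    split_ifs at h1 h2 with h
    · obtain rfl : l = k := by omega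
      rw [if_pos h]
    · have h0 : 0 < 2 ^ Nat.log 2 (offset k) := by positivity
      have h00 : 0 < 2 ^ level k := by positivity
      obtain ⟨h3, h4, h5⟩ := nestedDyadic_aux (l := l) h (by omega) (by omega)
      rw [if_neg h, if_neg h4, h3, h5]
  len_eq k l h1 h2 := by
    split_ifs at h1 h2 with h
    · obtain rfl : l = k := by omega
      rw [if_pos h]
    · have h0 : 0 < 2 ^ Nat.log 2 (offset k) := by positivity
      have h00 : 0 < 2 ^ level k := by positivity
      obtain ⟨h3, h4, h5⟩ := nestedDyadic_aux (l := l) h (by omega) (by omega)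
      rw [if_neg h, if_neg h4, h5]

/-- The map `g` translates every interval of `σ` onto an interval of `τ`. -/
def IntervalPartition.Translates (σ τ : IntervalPartition) (g : ℕ → ℕ) : Prop :=
  ∀ k, ∃ d, τ.lo (g k) = σ.lo k + d ∧ τ.len (g k) = σ.len k ∧ ∀ l ∈ σ.block k, g l = l + d

/-- This makes the operator induced by `g` intertwine the averaging operators of `σ` and `τ`. -/
theorem IntervalPartition.Translates.sum_block {σ τ : IntervalPartition} {g : ℕ → ℕ}
    (h : σ.Translates τ g) {M : Type*} [AddCommMonoid M] (f : ℕ → M) (k : ℕ) :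
    ∑ l ∈ τ.block (g k), f l = ∑ l ∈ σ.block k, f (g l) := by
  obtain ⟨d, h1, h2, h3⟩ := h k
  rw [sum_congr (s₁ := σ.block k) rfl fun l hl => by rw [h3 l hl]]
  rw [block, block, h1, h2, add_right_comm, sum_Ico_add']

theorem IntervalPartition.Translates.len_eq {σ τ : IntervalPartition} {g : ℕ → ℕ}
    (h : σ.Translates τ g) (k : ℕ) : τ.len (g k) = σ.len k := by
  obtain ⟨d, -, h2, -⟩ := h k
  exact h2

/-- Embedding of the nested dyadic partition into itself that misses the longest intervals. -/
def nestEmb (k : ℕ) : ℕ := k + 2 ^ level k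

/-- Embedding of the dyadic partition onto the longest intervals of the nested one. -/
def longEmb (k : ℕ) : ℕ := k + 2 ^ (level k + 1)

theorem strictMono_nestEmb : StrictMono nestEmb := fun k l h => by
  have := Nat.pow_le_pow_right two_pos (level_mono h.le)
  simp only [nestEmb]; omega

theorem strictMono_longEmb : StrictMono longEmb := fun k l h => by
  have := Nat.pow_le_pow_right two_pos (Nat.succ_le_succ (level_mono h.le))
  simp only [longEmb, Nat.succ_eq_add_one] at *; omega

theorem level_offset_nestEmb (k : ℕ) :
    level (nestEmb k) = level k + 1 ∧ offset (nestEmb k) = offset k := by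
  have h1 := offset_add k
  have h2 := offset_lt k
  refine level_offset_of_eq ?_ ?_ <;> rw [pow_succ] <;> [rw [nestEmb]; skip] <;> omega

theorem level_offset_longEmb (k : ℕ) :
    level (longEmb k) = level k + 1 ∧ offset (longEmb k) = k + 1 := by
  have h1 := level_spec k
  refine level_offset_of_eq ?_ ?_ <;> [rw [longEmb]; skip] <;> omega

theorem translates_nestEmb : nestedDyadic.Translates nestedDyadic nestEmb := fun k => by
  obtain ⟨h1, h2⟩ := level_offset_nestEmb k
  refine ⟨2 ^ level k, ?_, ?_, fun l hl => ?_⟩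
  · simp only [nestedDyadic, h1, h2]
    split_ifs with h
    · rfl
    · rw [pow_succ]
      have : 0 < 2 ^ level k := by positivity
      have h0 : 0 < 2 ^ Nat.log 2 (offset k) := by positivity
      omega
  · simp only [nestedDyadic, h2]
  · rw [IntervalPartition.mem_block] at hl
    simp only [nestedDyadic] at hl
    rw [nestEmb]
    split_ifs at hl with h
    · obtain rfl : l = k := by omega
      rfl
    · have h0 : 0 < 2 ^ Nat.log 2 (offset k) := by positivity
      have h00 : 0 < 2 ^ level k := by positivity
      rw [(nestedDyadic_aux (l := l) h (by omega) (by omega)).1]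

theorem translates_longEmb : dyadic.Translates nestedDyadic longEmb := fun k => by
  obtain ⟨h1, h2⟩ := level_offset_longEmb k
  refine ⟨2 ^ (level k + 1), ?_, ?_, fun l hl => ?_⟩
  · simp only [nestedDyadic, dyadic, h1, h2]
    rw [if_neg (Nat.succ_ne_zero k)]
    change 2 ^ (level k + 1) + 2 ^ level k - 1 = _
    have : 0 < 2 ^ level k := by positivity
    omega
  · simp only [nestedDyadic, dyadic, h2]
    rw [if_neg (Nat.succ_ne_zero k)]
    rfl
  · rw [longEmb, mem_dyadic_block.1 hl]

theorem nestEmb_ne_longEmb (k l : ℕ) : nestEmb k ≠ longEmb l := fun h => by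
  obtain ⟨h1, h2⟩ := level_offset_nestEmb k
  obtain ⟨h3, h4⟩ := level_offset_longEmb l
  rw [h] at h1 h2
  have h5 : level k = level l := by omega
  have h6 := offset_lt k
  have h7 := level_spec l
  rw [h5] at h6
  omega

/-- In level `r + 1`, `nestEmb` covers the offsets below `2 ^ r` and `longEmb` the others; only the
index 0, alone in its level, is missed. -/
theorem exists_nestEmb_or_longEmb {k : ℕ} (hk : k ≠ 0) :
    (∃ l, nestEmb l = k) ∨ ∃ l, longEmb l = k := by
  have h1 := offset_add k
  have h2 := offset_lt k
  obtain ⟨r, hr⟩ : ∃ r, level k = r + 1 := by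
    refine Nat.exists_eq_succ_of_ne_zero fun h => ?_
    rw [h] at h1 h2
    omega
  rw [hr, pow_succ] at h1 h2
  rcases lt_or_ge (offset k) (2 ^ r) with h | h
  · left
    have := level_offset_of_eq (k := 2 ^ r + offset k - 1) (r := r) (by omega) h
    exact ⟨2 ^ r + offset k - 1, by rw [nestEmb, this.1]; omega⟩
  · right
    have h3 : 0 < 2 ^ r := by positivity
    have : level (offset k - 1) = r := by
      rw [level_eq_iff, pow_succ]; omega
    exact ⟨offset k - 1, by rw [longEmb, this, pow_succ]; omega⟩

theorem nestedDyadic_block_zero : nestedDyadic.block 0 = {0} := by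
  have : offset 0 = 0 := by simp [offset, level]
  ext l
  rw [IntervalPartition.mem_block]
  simp only [nestedDyadic, this, if_true, mem_singleton]
  omega

end Partitions

/-! ### The isomorphism between `S` and its sum with the kernel of dyadic averaging. -/

section Splitting

variable {𝕜 : Type*} [RCLike 𝕜] {S : Type*} [NormedAddCommGroup S] [NormedSpace 𝕜 S]
  [CompleteSpace S] {e : SchauderBasis 𝕜 S} {K : ℝ}

theorem Spreading.exists_embedding (hK : Spreading e K) {g : ℕ → ℕ} (hg : StrictMono g) :
    ∃ A : S →L[𝕜] S, ∀ k, A (e k) = e (g k) :=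
  exists_clm_of_dominated e (C := K) fun F a => hK.spread F g a (hg.strictMonoOn _)

theorem Spreading.exists_retraction (hK : Spreading e K) {g : ℕ → ℕ} (hg : StrictMono g) :
    ∃ A : S →L[𝕜] S, (∀ k, A (e (g k)) = e k) ∧ ∀ l, (∀ k, g k ≠ l) → A (e l) = 0 := by
  classical
  have hinv := Function.leftInverse_invFun hg.injective
  obtain ⟨A, hA⟩ := exists_clm_of_dominated e
    (w := fun l => if ∃ k, g k = l then e (Function.invFun g l) else 0) (C := K ^ 2) fun F a => by
      have h1 : StrictMonoOn (Function.invFun g) (F.filter fun l => ∃ k, g k = l) := by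
        intro l hl l' hl' hlt
        obtain ⟨k, rfl⟩ := (mem_filter.1 hl).2
        obtain ⟨k', rfl⟩ := (mem_filter.1 hl').2
        rw [hinv, hinv]
        exact hg.lt_iff_lt.1 hlt
      have h2 := hK.spread _ _ a h1
      have h3 := hK.subset _ _ a (filter_subset (fun l => ∃ k, g k = l) F)
      have h0 := hK.pos
      simp only [smul_ite, smul_zero, ← sum_filter]
      calc _ ≤ _ := h2
        _ ≤ K * (K * ‖∑ j ∈ F, a j • e j‖) := by gcongr
        _ = _ := by ring
  refine ⟨A, fun k => ?_, fun l hl => ?_⟩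
  · rw [hA, if_pos ⟨k, rfl⟩, hinv]
  · rw [hA, if_neg (by push Not; exact hl)]

/-- The space `S` is isomorphic to its direct sum with the kernel of the dyadic averaging
projection `q`, and the isomorphism is given by operators on `S`. -/
theorem Spreading.exists_absorption (hK : Spreading e K) :
    ∃ q U V B D : S →L[𝕜] S,
      (∀ k, q (e k) = (2 ^ level k : 𝕜)⁻¹ • ∑ l ∈ dyadic.block k, e l) ∧
      V * U = 1 ∧ V * B = 0 ∧ D * U = 0 ∧ D * B = 1 - q ∧ U * V + B * D = 1 := by
  obtain ⟨p, hp⟩ := exists_average hK nestedDyadic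
  obtain ⟨q, hq⟩ := exists_average hK dyadic
  obtain ⟨A, hA⟩ := hK.exists_embedding strictMono_nestEmb
  obtain ⟨B, hB⟩ := hK.exists_embedding strictMono_longEmb
  obtain ⟨A', hA', hA0⟩ := hK.exists_retraction strictMono_nestEmb
  obtain ⟨B', hB', hB0⟩ := hK.exists_retraction strictMono_longEmb
  have h1 : A' * A = 1 := clm_ext_basis e fun k => by simp [hA, hA']
  have h2 : B' * B = 1 := clm_ext_basis e fun k => by simp [hB, hB']
  have h3 : A' * B = 0 := clm_ext_basis e fun k => by
    simp [hB, hA0 _ fun l => nestEmb_ne_longEmb l k]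
  have h4 : B' * A = 0 := clm_ext_basis e fun k => by
    simp [hA, hB0 _ fun l => (nestEmb_ne_longEmb k l).symm]
  have h5 : p * A = A * p := clm_ext_basis e fun k => by
    simp [hA, hp, translates_nestEmb.sum_block, translates_nestEmb.len_eq]
  have h6 : p * B = B * q := clm_ext_basis e fun k => by
    simp [hB, hp, hq, translates_longEmb.sum_block, translates_longEmb.len_eq]
  have hidem : ∀ (σ : IntervalPartition) (P : S →L[𝕜] S),
      (∀ k, P (e k) = (σ.len k : 𝕜)⁻¹ • ∑ l ∈ σ.block k, e l) → P * P = P := by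
    intro σ P hP
    refine clm_ext_basis e fun k => ?_
    have hlen : (σ.len k : 𝕜) ≠ 0 := by exact_mod_cast (σ.len_pos k).ne'
    have : ∀ l ∈ σ.block k, P (e l) = P (e k) := fun l hl => by
      rw [hP, hP, σ.block_eq hl, σ.len_eq_of_mem hl]
    rw [mul_apply_eq_comp]
    conv_lhs => rw [hP k]
    rw [map_smul, map_sum, sum_congr rfl this, sum_const, σ.card_block,
      ← Nat.cast_smul_eq_nsmul 𝕜, smul_smul, inv_mul_cancel₀ hlen, one_smul]
  have h7 := hidem _ p hp
  have h8 := hidem _ q hq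
  have hcov : ∀ k, k ≠ 0 → (1 - A * A' - B * B') (e k) = 0 := fun k hk => by
    rcases exists_nestEmb_or_longEmb hk with ⟨l, rfl⟩ | ⟨l, rfl⟩
    · simp [hA', hA, hB0 _ fun j => (nestEmb_ne_longEmb l j).symm]
    · simp [hB', hB, hA0 _ fun j => nestEmb_ne_longEmb j l]
  have hp0 : p (e 0) = e 0 := by
    have h : nestedDyadic.len 0 = 1 := by
      rw [← IntervalPartition.card_block, nestedDyadic_block_zero, card_singleton]
    simp [hp, nestedDyadic_block_zero, h]
  -- The two embeddings miss only `e 0`. Since 0 is an interval of its own, `p` fixes `e 0`, and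
  -- nothing is lost on the kernel of `p`.
  have h9 : (1 - A * A' - B * B') * (1 - p) = 0 := clm_ext_basis e fun k => by
    rw [mul_apply_eq_comp]
    rcases eq_or_ne k 0 with rfl | hk
    · simp [hp0]
    · have hne : ∀ l ∈ nestedDyadic.block k, (1 - A * A' - B * B') (e l) = 0 := by
        rintro l hl
        refine hcov l ?_
        rintro rfl
        rw [IntervalPartition.mem_block_comm, nestedDyadic_block_zero, mem_singleton] at hl
        exact hk hl
      rw [_root_.sub_apply (1 : S →L[𝕜] S), map_sub (1 - A * A' - B * B'), one_apply_eq_self, hcov k hk, hp, map_smul,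
        map_sum, sum_eq_zero hne]
      simp
  -- Multiplying `h9` by `A' * p`, and then by `B' * p`, shows that `A'` maps `ker p` to itself and
  -- `B'` maps it to `ker q`.
  have h10 : p * A' * (1 - p) = 0 := by
    linear_combination (norm := noncomm_ring) - A' * p * h9 - A' * h7 -
      A' * h5 * (A' * (1 - p)) - h1 * (p * A' * (1 - p)) - A' * h6 * (B' * (1 - p)) -
      h3 * (q * B' * (1 - p))
  have h11 : q * B' * (1 - p) = 0 := by
    linear_combination (norm := noncomm_ring) - B' * p * h9 - B' * h7 -
      B' * h5 * (A' * (1 - p)) - h4 * (p * A' * (1 - p)) - B' * h6 * (B' * (1 - p)) -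
      h2 * (q * B' * (1 - p))
  -- Now `ker p = A (ker p) ⊕ B (ker q)`; adding the range of `p`, left fixed, gives `S ≅ S ⊕ ker
  -- q`.
  refine ⟨q, p + A * (1 - p), p + A' * (1 - p), B * (1 - q), B' * (1 - p), fun k => ?_,
    ?_, ?_, ?_, ?_, ?_⟩
  · rw [hq]; simp [dyadic]
  · linear_combination (norm := noncomm_ring) h7 + h5 * (1 - p) - A * h7 - A' * h7 -
      A' * h5 * (1 - p) + A' * A * h7 + h1 * (1 - p)
  · linear_combination (norm := noncomm_ring) h6 * (1 - q) - B * h8 + h3 * (1 - q) -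
      A' * h6 * (1 - q) + A' * B * h8
  · linear_combination (norm := noncomm_ring) -B' * h7 + h4 * (1 - p) - B' * h5 * (1 - p)
      + B' * A * h7
  · linear_combination (norm := noncomm_ring) h2 * (1 - q) - B' * h6 * (1 - q) + B' * B * h8
  · linear_combination (norm := noncomm_ring) h7 + h10 - A * h7 - A * h10 - B * h11 - h9

end Splitting

/-! ### A highly conditional basis from a basis of type P. -/

section Construction

variable {𝕜 : Type*} [RCLike 𝕜] {X : Type*} [NormedAddCommGroup X] [NormedSpace 𝕜 X]

/-- A biorthogonal system with convergent expansions is a Schauder basis. -/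
def mkBasis (v : ℕ → X) (c : ℕ → StrongDual 𝕜 X) (ho : ∀ i j, c i (v j) = if i = j then 1 else 0)
    (hexp : ∀ f, Tendsto (fun n => ∑ k ∈ range n, c k f • v k) atTop (𝓝 f)) :
    SchauderBasis 𝕜 X where
  basis := v
  coord := c
  ortho i j := by simp [ho, Pi.single_apply]
  expansion f := by
    rw [HasSum, SummationFilter.conditional_filter_eq_map_range, tendsto_map'_iff]
    exact hexp f

theorem tendsto_of_levels {F : ℕ → X} {f : X} {N ℓ : ℕ → ℕ} (hℓ : Tendsto ℓ atTop atTop)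
    (hN : Tendsto (fun j => F (N j)) atTop (𝓝 f))
    (h : ∀ ε > 0, ∀ᶠ n in atTop, ‖F n - F (N (ℓ n))‖ ≤ ε) : Tendsto F atTop (𝓝 f) := by
  have h1 : Tendsto (fun n => F n - F (N (ℓ n))) atTop (𝓝 0) := by
    rw [NormedAddGroup.tendsto_nhds_zero]
    intro ε hε
    filter_upwards [h (ε / 2) (by positivity)] with n hn
    linarith
  simpa using h1.add (hN.comp hℓ)

theorem tendsto_level : Tendsto level atTop atTop :=
  tendsto_atTop_mono' _ (Eventually.of_forall fun _ => le_rfl)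
    (tendsto_atTop.2 fun b => by
      have hb : 0 < 2 ^ b := by positivity
      filter_upwards [eventually_ge_atTop (2 ^ b)] with n hn
      have h : level (2 ^ b - 1) = b := level_eq_iff.2 ⟨by omega, by rw [pow_succ]; omega⟩
      exact h ▸ level_mono (show 2 ^ b - 1 ≤ n by omega))

variable (x : SchauderBasis 𝕜 X)

theorem tail_small (f : X) {ε : ℝ} (hε : 0 < ε) :
    ∃ N, ∀ a b, N ≤ a → ‖∑ k ∈ Ico a b, x.coord k f • x k‖ ≤ ε := by
  have h := (x.tendsto_proj f).cauchySeq
  rw [Metric.cauchySeq_iff] at h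
  obtain ⟨N, hN⟩ := h ε hε
  refine ⟨N, fun a b ha => ?_⟩
  rcases le_total a b with hab | hab
  · have := (hN b (ha.trans hab) a ha).le
    rwa [dist_eq_norm, SchauderBasis.proj_apply, SchauderBasis.proj_apply,
      ← sum_Ico_eq_sub _ hab] at this
  · simp [Ico_eq_empty_of_le hab, hε.le]

theorem exists_norm_coord_le [CompleteSpace X] {c : ℝ} (hc : 0 < c) (h : ∀ j, c ≤ ‖x j‖) :
    ∃ C : ℝ, 0 < C ∧ ∀ j, ‖x.coord j‖ ≤ C := by
  obtain ⟨D, hD⟩ := x.exists_norm_proj_le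
  have hD0 : 0 ≤ D := (norm_nonneg _).trans (hD 0)
  refine ⟨2 * D / c + 1, by positivity, fun j => ?_⟩
  refine ContinuousLinearMap.opNorm_le_bound _ (by positivity) fun f => ?_
  have h1 : ‖x.coord j f‖ * ‖x j‖ ≤ 2 * D * ‖f‖ := by
    have h2 : x.coord j f • x j = x.proj (j + 1) f - x.proj j f := by
      rw [SchauderBasis.proj_apply, SchauderBasis.proj_apply, sum_range_succ]; abel
    rw [← norm_smul, h2]
    refine (norm_sub_le _ _).trans ?_
    have h3 := (x.proj (j + 1)).le_of_opNorm_le (hD _) f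
    have h4 := (x.proj j).le_of_opNorm_le (hD _) f
    linarith
  have h5 : ‖x.coord j f‖ ≤ 2 * D / c * ‖f‖ := by
    rw [div_mul_eq_mul_div, le_div_iff₀ hc]
    exact (mul_le_mul_of_nonneg_left (h j) (norm_nonneg _)).trans h1
  nlinarith [norm_nonneg f]

/-- The length of the dyadic interval containing `m`. -/
def dyadicLen (m : ℕ) : ℕ := 2 ^ level m

theorem dyadicLen_spec (m : ℕ) : dyadicLen m ≤ m + 1 ∧ m + 1 < 2 * dyadicLen m := by
  have := level_spec m
  rw [pow_succ] at this
  rw [dyadicLen]; omega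

theorem dyadicLen_trichotomy (m n : ℕ) : dyadicLen m = dyadicLen n ∨
    2 * dyadicLen m ≤ dyadicLen n ∨ 2 * dyadicLen n ≤ dyadicLen m := by
  simp only [dyadicLen, ← pow_succ']
  rcases lt_trichotomy (level m) (level n) with h | h | h
  · right; left; exact Nat.pow_le_pow_right two_pos h
  · left; rw [h]
  · right; right; exact Nat.pow_le_pow_right two_pos h

theorem dyadicLen_eq {m i : ℕ} (h1 : 2 ^ i ≤ m + 1) (h2 : m + 1 < 2 * 2 ^ i) :
    dyadicLen m = 2 ^ i := by
  rw [dyadicLen, level_eq_iff.2 ⟨h1, by rw [pow_succ']; exact h2⟩]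

/-- Partial sums of the first half of a dyadic block of the basis. -/
def halfSum (m : ℕ) : X := ∑ l ∈ Ico (2 * dyadicLen m - 2) (dyadicLen m + m), x l

/-- The coordinate functionals of `halfSum`. -/
def halfSumCoord (m : ℕ) : StrongDual 𝕜 X :=
  x.coord (dyadicLen m + m - 1) -
    if m + 2 < 2 * dyadicLen m then x.coord (dyadicLen m + m) else 0

/-- The basis that alternates partial sums of the first half of each dyadic block with their
perturbations by the vectors of the second half. -/
def alternating (n : ℕ) : X :=
  if n % 2 = 0 then halfSum x (n / 2)
  else halfSum x (n / 2) + x (2 * dyadicLen (n / 2) + n / 2 - 1)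

/-- The coordinate functionals of `alternating`. -/
def alternatingCoord (n : ℕ) : StrongDual 𝕜 X :=
  if n % 2 = 0 then halfSumCoord x (n / 2) - x.coord (2 * dyadicLen (n / 2) + n / 2 - 1)
  else x.coord (2 * dyadicLen (n / 2) + n / 2 - 1)

theorem alternating_even (m : ℕ) : alternating x (2 * m) = halfSum x m := by
  simp [alternating]

theorem alternating_odd (m : ℕ) :
    alternating x (2 * m + 1) = halfSum x m + x (2 * dyadicLen m + m - 1) := by
  have : (2 * m + 1) / 2 = m := by omega
  simp [alternating, this, Nat.add_mod]

theorem alternatingCoord_even (m : ℕ) : alternatingCoord x (2 * m) =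
    halfSumCoord x m - x.coord (2 * dyadicLen m + m - 1) := by
  simp [alternatingCoord]

theorem alternatingCoord_odd (m : ℕ) :
    alternatingCoord x (2 * m + 1) = x.coord (2 * dyadicLen m + m - 1) := by
  have : (2 * m + 1) / 2 = m := by omega
  simp [alternatingCoord, this, Nat.add_mod]

theorem coord_apply_basis (i j : ℕ) : x.coord i (x j) = if i = j then 1 else 0 := by
  simp [x.ortho, Pi.single_apply]

theorem coord_halfSum (l m : ℕ) : x.coord l (halfSum x m) =
    if 2 * dyadicLen m - 2 ≤ l ∧ l < dyadicLen m + m then 1 else 0 := by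
  simp only [halfSum, map_sum, coord_apply_basis, sum_ite_eq, mem_Ico]

theorem second_coord_halfSum (m n : ℕ) :
    x.coord (2 * dyadicLen m + m - 1) (halfSum x n) = 0 := by
  rw [coord_halfSum, if_neg]
  have := dyadicLen_spec m
  have := dyadicLen_spec n
  have := dyadicLen_trichotomy m n
  omega

theorem second_coord_second (m n : ℕ) :
    x.coord (2 * dyadicLen m + m - 1) (x (2 * dyadicLen n + n - 1)) = if m = n then 1 else 0 := by
  rw [coord_apply_basis]
  refine if_congr ⟨fun h => ?_, fun h => by rw [h]⟩ rfl rfl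
  have := dyadicLen_spec m
  have := dyadicLen_spec n
  have := dyadicLen_trichotomy m n
  omega

theorem halfSumCoord_second (m n : ℕ) :
    halfSumCoord x m (x (2 * dyadicLen n + n - 1)) = 0 := by
  have := dyadicLen_spec m
  have := dyadicLen_spec n
  have := dyadicLen_trichotomy m n
  rw [halfSumCoord, _root_.sub_apply, coord_apply_basis, if_neg (by omega)]
  split_ifs with h
  · rw [coord_apply_basis, if_neg (by omega), sub_zero]
  · simp

theorem halfSumCoord_halfSum (m n : ℕ) :
    halfSumCoord x m (halfSum x n) = if m = n then 1 else 0 := by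
  have h1 := dyadicLen_spec m
  have h2 := dyadicLen_spec n
  have h3 := dyadicLen_trichotomy m n
  rw [halfSumCoord, _root_.sub_apply, coord_halfSum]
  have h4 : (if m + 2 < 2 * dyadicLen m then x.coord (dyadicLen m + m) else 0) (halfSum x n) =
      if m < n ∧ dyadicLen m = dyadicLen n then 1 else 0 := by
    split_ifs with h h' h'
    · rw [coord_halfSum, if_pos (by omega)]
    · rw [coord_halfSum, if_neg (by omega)]
    · omega
    · simp
  rw [h4]
  by_cases hmn : m = n
  · subst hmn
    rw [if_pos (by omega), if_neg (by omega), if_pos rfl, sub_zero]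
  · rw [if_neg hmn]
    by_cases h5 : m < n ∧ dyadicLen m = dyadicLen n
    · rw [if_pos h5, if_pos (by omega), sub_self]
    · rw [if_neg h5, if_neg (by omega), sub_zero]

theorem alternating_ortho (i j : ℕ) :
    alternatingCoord x i (alternating x j) = if i = j then 1 else 0 := by
  obtain ⟨m, rfl | rfl⟩ := Nat.even_or_odd' i <;> obtain ⟨n, rfl | rfl⟩ := Nat.even_or_odd' j
  · rw [alternatingCoord_even, alternating_even, _root_.sub_apply, halfSumCoord_halfSum,
      second_coord_halfSum, sub_zero]
    exact if_congr (by omega) rfl rfl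
  · rw [alternatingCoord_even, alternating_odd, _root_.sub_apply, map_add, map_add,
      halfSumCoord_halfSum, second_coord_halfSum, halfSumCoord_second, second_coord_second,
      if_neg (show ¬ 2 * m = 2 * n + 1 by omega)]
    abel
  · rw [alternatingCoord_odd, alternating_even, second_coord_halfSum, if_neg (by omega)]
  · rw [alternatingCoord_odd, alternating_odd, map_add, second_coord_halfSum,
      second_coord_second, zero_add]
    exact if_congr (by omega) rfl rfl

/-- Partial sums of the expansion with respect to `alternating`. -/
def alternatingSum (f : X) (n : ℕ) : X :=
  ∑ k ∈ range n, alternatingCoord x k f • alternating x k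

theorem alternatingSum_step (f : X) (m : ℕ) : alternatingSum x f (2 * (m + 1)) =
    alternatingSum x f (2 * m) + halfSumCoord x m f • halfSum x m +
      x.coord (2 * dyadicLen m + m - 1) f • x (2 * dyadicLen m + m - 1) := by
  rw [alternatingSum, show 2 * (m + 1) = 2 * m + 1 + 1 by ring, sum_range_succ, sum_range_succ,
    alternatingCoord_even, alternatingCoord_odd, alternating_even, alternating_odd,
    alternatingSum, _root_.sub_apply]
  module

/-- Summation by parts: inside a block the functionals `halfSumCoord` are differences of
coordinates, so the expansion reproduces the two halves of the expansion in `x`, up to one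
coordinate times a partial sum of the `x l`. Type P bounds that sum. At the end of the block the
truncated last functional removes the correction. -/
theorem alternatingSum_sub (f : X) {i M : ℕ} (h1 : 2 ^ i ≤ M + 1) (h2 : M + 1 ≤ 2 * 2 ^ i) :
    alternatingSum x f (2 * M) - alternatingSum x f (2 * 2 ^ i - 2) =
      ∑ l ∈ Ico (2 * 2 ^ i - 2) (2 ^ i + M - 1), x.coord l f • x l +
      ∑ l ∈ Ico (3 * 2 ^ i - 2) (2 * 2 ^ i + M - 1), x.coord l f • x l -
      if M + 1 < 2 * 2 ^ i then x.coord (2 ^ i + M - 1) f •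
        ∑ l ∈ Ico (2 * 2 ^ i - 2) (2 ^ i + M - 1), x l else 0 := by
  have hpos : 0 < 2 ^ i := by positivity
  obtain ⟨q, rfl⟩ : ∃ q, M = 2 ^ i - 1 + q := ⟨M + 1 - 2 ^ i, by omega⟩
  induction q with
  | zero =>
    rw [Ico_eq_empty_of_le (by omega), Ico_eq_empty_of_le (by omega),
      show 2 * (2 ^ i - 1 + 0) = 2 * 2 ^ i - 2 by omega]
    simp
  | succ q ih =>
    have h3 := ih (by omega) (by omega)
    have hJ : dyadicLen (2 ^ i - 1 + q) = 2 ^ i := dyadicLen_eq (by omega) (by omega)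
    rw [← add_assoc, alternatingSum_step, halfSum, halfSumCoord, hJ]
    rw [if_pos (by omega)] at h3
    set m := 2 ^ i - 1 + q with hm
    have e1 : 2 ^ i + (m + 1) - 1 = 2 ^ i + m - 1 + 1 := by omega
    have e2 : 2 * 2 ^ i + (m + 1) - 1 = 2 * 2 ^ i + m - 1 + 1 := by omega
    have e3 : 2 ^ i + m = 2 ^ i + m - 1 + 1 := by omega
    rw [e1, e2, sum_Ico_succ_top (by omega), sum_Ico_succ_top (by omega),
      sum_Ico_succ_top (by omega), e3, sum_Ico_succ_top (by omega), _root_.sub_apply]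
    rw [sub_eq_iff_eq_add] at h3
    rw [h3]
    rw [show m + 2 = m + 1 + 1 by ring, Nat.add_sub_cancel]
    split_ifs
    · module
    · rw [_root_.zero_apply]; module

theorem alternatingSum_dyadic (f : X) (i : ℕ) :
    alternatingSum x f (2 * 2 ^ i - 2) = x.proj (2 * 2 ^ i - 2) f := by
  rw [SchauderBasis.proj_apply]
  induction i with
  | zero => simp [alternatingSum]
  | succ i ih =>
    have hpos : 0 < 2 ^ i := by positivity
    have h := alternatingSum_sub x f (i := i) (M := 2 * 2 ^ i - 1) (by omega) (by omega)
    rw [if_neg (by omega), sub_zero, sub_eq_iff_eq_add, ih] at h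
    rw [pow_succ, show 2 * (2 ^ i * 2) - 2 = 2 * (2 * 2 ^ i - 1) by omega, h, add_comm,
      show 2 ^ i + (2 * 2 ^ i - 1) - 1 = 3 * 2 ^ i - 2 by omega,
      sum_Ico_consecutive _ (by omega) (by omega), sum_range_add_sum_Ico _ (by omega)]
    congr 2
    omega

theorem TypeP.sum_Ico_le {x : SchauderBasis 𝕜 X} {C : ℝ}
    (hx : ∀ k : ℕ, ‖∑ j ∈ range k, x j‖ ≤ C) (a b : ℕ) : ‖∑ l ∈ Ico a b, x l‖ ≤ 2 * C := by
  have hC : 0 ≤ C := (norm_nonneg _).trans (hx 0)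
  rcases le_total a b with hab | hab
  · rw [sum_Ico_eq_sub _ hab]
    refine (norm_sub_le _ _).trans ?_
    linarith [hx a, hx b]
  · simp [Ico_eq_empty_of_le hab, hC]

theorem alternatingSum_tendsto [CompleteSpace X] {c C : ℝ}
    (hx : ∀ k : ℕ, ‖∑ j ∈ range k, x j‖ ≤ C) (hc : 0 < c) (hxc : ∀ j, c ≤ ‖x j‖) (f : X) :
    Tendsto (alternatingSum x f) atTop (𝓝 f) := by
  have hC : 0 ≤ C := (norm_nonneg _).trans (hx 0)
  have hdiv : Tendsto (fun n : ℕ => n / 2) atTop atTop :=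
    Nat.tendsto_div_const_atTop two_ne_zero
  refine tendsto_of_levels (N := fun i => 2 * 2 ^ i - 2) (ℓ := fun n => level (n / 2))
    (tendsto_level.comp hdiv) ?_ ?_
  · simp only [alternatingSum_dyadic]
    refine (x.tendsto_proj f).comp (tendsto_atTop_mono (fun i => ?_) tendsto_id)
    have := Nat.lt_two_pow_self (n := i)
    simp only [id]; omega
  · intro ε hε
    -- Two tails and the boundary correction give `2 + 2 * C / c`; an unpaired even term gives up to
    -- `6 * C / c`.
    obtain ⟨δ, hδ, hδε⟩ : ∃ δ > 0, (2 + 8 * C / c) * δ ≤ ε :=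
      ⟨ε / (2 + 8 * C / c), by positivity, by rw [mul_div_cancel₀ _ (by positivity)]⟩
    obtain ⟨N, hN⟩ := tail_small x f hδ
    have hcoord : ∀ j, N ≤ j → ‖x.coord j f‖ ≤ δ / c := fun j hj => by
      have := hN j (j + 1) hj
      rw [Nat.Ico_succ_singleton, sum_singleton, norm_smul] at this
      rw [le_div_iff₀ hc]
      exact (mul_le_mul_of_nonneg_left (hxc j) (norm_nonneg _)).trans this
    have hterm : ∀ j a b, N ≤ j → ‖x.coord j f • ∑ l ∈ Ico a b, x l‖ ≤ 2 * C / c * δ := by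
      intro j a b hj
      rw [norm_smul]
      calc _ ≤ δ / c * (2 * C) := by
            gcongr
            · exact hcoord j hj
            · exact TypeP.sum_Ico_le hx a b
        _ = _ := by ring
    have hmain : ∀ M, N + 2 ≤ M →
        ‖alternatingSum x f (2 * M) - alternatingSum x f (2 * dyadicLen M - 2)‖ ≤
          (2 + 2 * C / c) * δ := by
      intro M hM
      have hlen := dyadicLen_spec M
      have hs := alternatingSum_sub x f hlen.1 hlen.2.le
      rw [← dyadicLen, if_pos hlen.2] at hs
      rw [hs]
      have t1 := hN (2 * dyadicLen M - 2) (dyadicLen M + M - 1) (by omega)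
      have t2 := hN (3 * dyadicLen M - 2) (2 * dyadicLen M + M - 1) (by omega)
      have t3 := hterm (dyadicLen M + M - 1) (2 * dyadicLen M - 2) (dyadicLen M + M - 1)
        (by omega)
      refine (norm_sub_le _ _).trans ((add_le_add (norm_add_le _ _) le_rfl).trans ?_)
      linarith
    filter_upwards [eventually_ge_atTop (2 * (N + 2))] with n hn
    change ‖alternatingSum x f n - alternatingSum x f (2 * dyadicLen (n / 2) - 2)‖ ≤ ε
    refine le_trans ?_ hδε
    have hCc : 0 ≤ C / c := by positivity
    obtain ⟨m, rfl | rfl⟩ := Nat.even_or_odd' n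
    · rw [Nat.mul_div_cancel_left _ two_pos]
      refine (hmain m (by omega)).trans ?_
      gcongr
      norm_num
    · have hm : (2 * m + 1) / 2 = m := by omega
      have hlen := dyadicLen_spec m
      rw [hm, alternatingSum, sum_range_succ, ← alternatingSum, alternatingCoord_even,
        alternating_even, add_sub_right_comm]
      refine (norm_add_le _ _).trans ?_
      have t1 := hmain m (by omega)
      have t2 : ‖(halfSumCoord x m - x.coord (2 * dyadicLen m + m - 1)) f • halfSum x m‖ ≤
          6 * C / c * δ := by
        have s1 := hterm (dyadicLen m + m - 1) (2 * dyadicLen m - 2) (dyadicLen m + m) (by omega)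
        have s2 := hterm (dyadicLen m + m) (2 * dyadicLen m - 2) (dyadicLen m + m) (by omega)
        have s3 := hterm (2 * dyadicLen m + m - 1) (2 * dyadicLen m - 2) (dyadicLen m + m)
          (by omega)
        rw [halfSumCoord, _root_.sub_apply, _root_.sub_apply, sub_smul, sub_smul, halfSum]
        refine (norm_sub_le _ _).trans ((add_le_add (norm_sub_le _ _) le_rfl).trans ?_)
        split_ifs
        · calc _ ≤ _ := add_le_add (add_le_add s1 s2) s3
            _ = _ := by ring
        · rw [_root_.zero_apply, zero_smul, norm_zero, add_zero]
          calc _ ≤ _ := add_le_add s1 s3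
            _ ≤ _ := by
              have : 0 ≤ C / c * δ := by positivity
              rw [mul_div_assoc, mul_div_assoc]
              linarith
      refine (add_le_add t1 t2).trans_eq ?_
      ring

/-- A space with a basis of type P has a bounded basis that is as conditional as possible. -/
theorem TypeP.exists_conditional [CompleteSpace X] {x : SchauderBasis 𝕜 X} (hx : TypeP x) :
    ∃ y : SchauderBasis 𝕜 X, (∃ C : ℝ, 0 < C ∧ ∀ n, ‖y n‖ ≤ C ∧ ‖y.coord n‖ ≤ C) ∧
      ∃ c : ℝ, 0 < c ∧ ∀ i : ℕ, ∃ (f : X) (A : Finset ℕ), f ≠ 0 ∧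
        (∀ n, 4 * 2 ^ i ≤ n → y.coord n f = 0) ∧
        c * 2 ^ i * ‖f‖ ≤ ‖∑ n ∈ A, y.coord n f • y n‖ := by
  obtain ⟨⟨C, hC⟩, c, hc, hxc⟩ := hx
  have hC0 : 0 ≤ C := (norm_nonneg _).trans (hC 0)
  obtain ⟨D, hD0, hD⟩ := exists_norm_coord_le x hc hxc
  have hx2 : ∀ l, ‖x l‖ ≤ 2 * C := fun l => by
    simpa [Nat.Ico_succ_singleton] using TypeP.sum_Ico_le hC l (l + 1)
  refine ⟨mkBasis (alternating x) (alternatingCoord x) (alternating_ortho x)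
    (alternatingSum_tendsto x hC hc hxc), ⟨4 * C + 3 * D, by positivity, fun n => ?_⟩,
    -- The test vector has norm at most `2 * (C + 1)`, and `D` bounds the coordinate functionals of
    -- `x`.
    (2 * (C + 1) * D)⁻¹, by positivity, fun i => ?_⟩
  · change ‖alternating x n‖ ≤ _ ∧ ‖alternatingCoord x n‖ ≤ _
    obtain ⟨m, rfl | rfl⟩ := Nat.even_or_odd' n
    · rw [alternating_even, alternatingCoord_even]
      constructor
      · have h1 := TypeP.sum_Ico_le hC (2 * dyadicLen m - 2) (dyadicLen m + m)
        rw [← halfSum] at h1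
        linarith
      · refine (norm_sub_le _ _).trans ((add_le_add (norm_sub_le _ _) le_rfl).trans ?_)
        have := hD (dyadicLen m + m - 1)
        have := hD (2 * dyadicLen m + m - 1)
        split_ifs
        · linarith [hD (dyadicLen m + m)]
        · rw [norm_zero]; linarith
    · rw [alternating_odd, alternatingCoord_odd]
      constructor
      · refine (norm_add_le _ _).trans ?_
        have h1 := TypeP.sum_Ico_le hC (2 * dyadicLen m - 2) (dyadicLen m + m)
        rw [← halfSum] at h1
        linarith [hx2 (2 * dyadicLen m + m - 1)]
      · linarith [hD (2 * dyadicLen m + m - 1)]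
  · have hpos : 0 < 2 ^ i := by positivity
    let I := Ico (2 ^ i - 1) (2 * 2 ^ i - 1)
    have hI : ∀ m ∈ I, dyadicLen m = 2 ^ i := fun m hm => by
      simp only [I, mem_Ico] at hm
      exact dyadicLen_eq (by omega) (by omega)
    -- A sum of consecutive `x l`, bounded by type P. Its coefficients alternate between `-1` and
    -- `1`, so the half sums cancel in `f` but pile up when only the odd terms are kept.
    let f : X := ∑ m ∈ I, x (2 * dyadicLen m + m - 1)
    have hf : ‖f‖ ≤ 2 * (C + 1) := by
      have h1 : f = ∑ l ∈ Ico (3 * 2 ^ i - 2) (4 * 2 ^ i - 2), x l := by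
        simp only [f]
        rw [sum_congr rfl fun m hm => by rw [hI m hm], sum_Ico_eq_sum_range,
          sum_Ico_eq_sum_range]
        refine sum_congr (by congr 1; omega) fun l _ => ?_
        congr 1; omega
      rw [h1]
      linarith [TypeP.sum_Ico_le hC (3 * 2 ^ i - 2) (4 * 2 ^ i - 2)]
    have hodd : ∀ m, alternatingCoord x (2 * m + 1) f = if m ∈ I then 1 else 0 := fun m => by
      rw [alternatingCoord_odd, map_sum]
      simp only [second_coord_second]
      rw [sum_ite_eq]
    have heven : ∀ m, alternatingCoord x (2 * m) f = if m ∈ I then -1 else 0 := fun m => by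
      rw [alternatingCoord_even, _root_.sub_apply, map_sum, map_sum]
      simp only [second_coord_second, halfSumCoord_second]
      rw [sum_ite_eq, sum_const_zero, zero_sub]
      split_ifs <;> simp
    have hmemI : 2 ^ i - 1 ∈ I := by simp only [I, mem_Ico]; omega
    refine ⟨f, I.image fun m => 2 * m + 1, fun h0 => ?_, fun n hn => ?_, ?_⟩
    · have := hodd (2 ^ i - 1)
      rw [h0, if_pos hmemI] at this
      simp at this
    · change alternatingCoord x n f = 0
      obtain ⟨m, rfl | rfl⟩ := Nat.even_or_odd' n
      · rw [heven, if_neg]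
        simp only [I, mem_Ico]; omega
      · rw [hodd, if_neg]
        simp only [I, mem_Ico]; omega
    · change _ ≤ ‖∑ n ∈ I.image fun m => 2 * m + 1, alternatingCoord x n f • alternating x n‖
      rw [sum_image (fun a _ b _ h => by simpa using h)]
      have h1 : ∑ m ∈ I, alternatingCoord x (2 * m + 1) f • alternating x (2 * m + 1) =
          ∑ m ∈ I, (halfSum x m + x (2 * dyadicLen m + m - 1)) :=
        sum_congr rfl fun m hm => by rw [hodd, if_pos hm, one_smul, alternating_odd]
      rw [h1]
      set g := ∑ m ∈ I, (halfSum x m + x (2 * dyadicLen m + m - 1))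
      -- All `2 ^ i` half sums of the block begin at the index `2 * 2 ^ i - 2`.
      have h2 : x.coord (2 * 2 ^ i - 2) g = (2 ^ i : ℕ) := by
        simp only [g, map_sum, map_add]
        rw [sum_congr rfl (g := fun _ => (1 : 𝕜)) fun m hm => ?_]
        · simp only [sum_const, I, Nat.card_Ico, nsmul_eq_mul, mul_one]
          congr 1; omega
        · have h3 := hm
          simp only [I, mem_Ico] at h3
          rw [coord_halfSum, hI m hm, if_pos (by omega), coord_apply_basis, if_neg (by omega),
            add_zero]
      have h3 := (x.coord (2 * 2 ^ i - 2)).le_of_opNorm_le (hD _) g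
      rw [h2, RCLike.norm_natCast] at h3
      push_cast at h3
      calc (2 * (C + 1) * D)⁻¹ * 2 ^ i * ‖f‖
          ≤ (2 * (C + 1) * D)⁻¹ * (D * ‖g‖) * (2 * (C + 1)) := by gcongr
        _ = ‖g‖ := by field_simp

end Construction

/-! ### The glued basis. -/

section Gluing

variable {𝕜 : Type*} [RCLike 𝕜] {S : Type*} [NormedAddCommGroup S] [NormedSpace 𝕜 S]
  {X : Type*} [NormedAddCommGroup X] [NormedSpace 𝕜 X]
  {Y : Type*} [NormedAddCommGroup Y] [NormedSpace 𝕜 Y]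

/-- The set of indices of level `n`. -/
def levelSet (n : ℕ) : Finset ℕ := Ico (2 ^ n - 1) (2 ^ (n + 1) - 1)

theorem mem_levelSet {n k : ℕ} : k ∈ levelSet n ↔ level k = n := by
  have h : 0 < 2 ^ n := by positivity
  rw [levelSet, mem_Ico, level_eq_iff, pow_succ]
  omega

theorem card_levelSet (n : ℕ) : (levelSet n).card = 2 ^ n := by
  have h : 0 < 2 ^ n := by positivity
  rw [levelSet, Nat.card_Ico, pow_succ]
  omega

theorem dyadic_block_eq (k : ℕ) : dyadic.block k = levelSet (level k) := by
  ext l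
  rw [mem_dyadic_block, mem_levelSet]

theorem sum_range_levels {M : Type*} [AddCommMonoid M] (f : ℕ → M) (r : ℕ) :
    ∑ k ∈ range (2 ^ r - 1), f k = ∑ n ∈ range r, ∑ k ∈ levelSet n, f k := by
  induction r with
  | zero => simp
  | succ r ih =>
    have h : 0 < 2 ^ r := by positivity
    rw [sum_range_succ, ← ih, levelSet, sum_range_add_sum_Ico _ (by rw [pow_succ]; omega)]

/-- A decomposition of `Y` as a direct sum of `X` and of the kernel of the averaging projection
of `S` over dyadic intervals. -/
structure Gluing (e : SchauderBasis 𝕜 S) (X Y : Type*) [NormedAddCommGroup X] [NormedSpace 𝕜 X]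
    [NormedAddCommGroup Y] [NormedSpace 𝕜 Y] where
  inX : X →L[𝕜] Y
  inS : S →L[𝕜] Y
  toX : Y →L[𝕜] X
  toS : Y →L[𝕜] S
  avg : S →L[𝕜] S
  avg_basis : ∀ k, avg (e k) = (2 ^ level k : 𝕜)⁻¹ • ∑ l ∈ dyadic.block k, e l
  toX_inX : ∀ g, toX (inX g) = g
  toX_inS : ∀ s, toX (inS s) = 0
  toS_inX : ∀ g, toS (inX g) = 0
  toS_inS : ∀ s, toS (inS s) = s - avg s
  inX_toX_add : ∀ h, inX (toX h) + inS (toS h) = h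

/-- If `S` is complemented in `X`, then `X` is a direct sum of itself and of the kernel of the
averaging projection. -/
theorem Spreading.exists_gluing [CompleteSpace S] {e : SchauderBasis 𝕜 S} {K : ℝ}
    (hK : Spreading e K) (h : ComplementablyEmbeds 𝕜 S X) : Nonempty (Gluing e X X) := by
  obtain ⟨L, T, hTL⟩ := h
  obtain ⟨q, U, V, B, D, hq, hVU, hVB, hDU, hDB, hUV⟩ := hK.exists_absorption
  have hTL : ∀ s, T (L s) = s := fun s => by
    simpa using congrArg (fun A : S →L[𝕜] S => A s) hTL
  have hVU : ∀ s, V (U s) = s := fun s => by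
    simpa using congrArg (fun A : S →L[𝕜] S => A s) hVU
  have hVB : ∀ s, V (B s) = 0 := fun s => by
    simpa using congrArg (fun A : S →L[𝕜] S => A s) hVB
  have hDU : ∀ s, D (U s) = 0 := fun s => by
    simpa using congrArg (fun A : S →L[𝕜] S => A s) hDU
  have hDB : ∀ s, D (B s) = s - q s := fun s => by
    simpa using congrArg (fun A : S →L[𝕜] S => A s) hDB
  have hUV : ∀ s, U (V s) + B (D s) = s := fun s => by
    simpa using congrArg (fun A : S →L[𝕜] S => A s) hUV
  refine ⟨{
    -- On the complement `ker T` of the copy of `S` nothing changes; on the copy itself the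
    -- isomorphism `S ≅ S ⊕ ker q` is transported by `L` and `T`.
    inX := ContinuousLinearMap.id 𝕜 X - L.comp T + L.comp (U.comp T)
    inS := L.comp B
    toX := ContinuousLinearMap.id 𝕜 X - L.comp T + L.comp (V.comp T)
    toS := D.comp T
    avg := q
    avg_basis := hq
    toX_inX := fun g => ?_
    toX_inS := fun s => ?_
    toS_inX := fun g => ?_
    toS_inS := fun s => ?_
    inX_toX_add := fun h => ?_ }⟩
  · simp [hTL, hVU]
  · simp [hTL, hVB]
  · simp [hTL, hDU]
  · simp [hTL, hDB]
  · simp only [_root_.add_apply, _root_.sub_apply, ContinuousLinearMap.comp_apply,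
      ContinuousLinearMap.id_apply, map_add, map_sub, hTL, sub_self, zero_add]
    have h1 := congrArg L (hUV (T h))
    rw [map_add] at h1
    rw [add_assoc, h1]
    abel

namespace Gluing

variable {e : SchauderBasis 𝕜 S} (Γ : Gluing e X Y) (y : SchauderBasis 𝕜 X)

theorem avg_toS (h : Y) : Γ.avg (Γ.toS h) = 0 := by
  have h1 := congrArg Γ.toS (Γ.inX_toX_add h)
  rw [map_add, Γ.toS_inX, Γ.toS_inS, zero_add] at h1
  simpa using h1

theorem inS_avg (s : S) : Γ.inS (Γ.avg s) = 0 := by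
  have h1 := Γ.inX_toX_add (Γ.inS s)
  rw [Γ.toX_inS, Γ.toS_inS, map_zero, map_sub, zero_add] at h1
  simpa using h1

theorem coord_avg (l : ℕ) (s : S) :
    e.coord l (Γ.avg s) = (2 ^ level l : 𝕜)⁻¹ * ∑ k ∈ levelSet (level l), e.coord k s := by
  have : (e.coord l).comp Γ.avg = (2 ^ level l : 𝕜)⁻¹ • ∑ k ∈ levelSet (level l), e.coord k := by
    refine clm_ext_basis e fun k => ?_
    simp only [ContinuousLinearMap.comp_apply, Γ.avg_basis, map_smul, map_sum, coord_apply_basis,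
      _root_.smul_apply, _root_.sum_apply, sum_ite_eq, sum_ite_eq', mem_levelSet, mem_dyadic_block]
    by_cases h : level l = level k
    · simp [h]
    · simp [h, Ne.symm h]
  have h1 := congrArg (fun A : StrongDual 𝕜 S => A s) this
  simpa [_root_.sum_apply] using h1

theorem sum_coord_toS (n : ℕ) (h : Y) : ∑ k ∈ levelSet n, e.coord k (Γ.toS h) = 0 := by
  have hn : level (2 ^ n - 1) = n := mem_levelSet.1 (by
    have : 0 < 2 ^ n := by positivity
    rw [levelSet, mem_Ico, pow_succ]; omega)
  have h1 := Γ.coord_avg (2 ^ n - 1) (Γ.toS h)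
  rw [Γ.avg_toS, map_zero, hn] at h1
  simpa using h1.symm

theorem sum_inS (n : ℕ) : ∑ k ∈ levelSet n, Γ.inS (e k) = 0 := by
  have hn : level (2 ^ n - 1) = n := mem_levelSet.1 (by
    have : 0 < 2 ^ n := by positivity
    rw [levelSet, mem_Ico, pow_succ]; omega)
  have h1 := Γ.inS_avg (e (2 ^ n - 1))
  rw [Γ.avg_basis, dyadic_block_eq, hn, map_smul, map_sum] at h1
  simpa using h1

/-- The weights that turn constant coefficients on a level into normalized ones. -/
def _root_.GreedyBases.weight (e : SchauderBasis 𝕜 S) (k : ℕ) : ℝ :=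
  sumNorm e (2 ^ level k) / 2 ^ level k

theorem _root_.GreedyBases.weight_nonneg (e : SchauderBasis 𝕜 S) (k : ℕ) : 0 ≤ weight e k :=
  div_nonneg (sumNorm_nonneg _ _) (by positivity)

/-- The vectors of the glued basis. -/
def vec (k : ℕ) : Y := (weight e k : 𝕜) • Γ.inX (y (level k)) + Γ.inS (e k)

/-- The coefficient of `h` common to the level `n`. -/
def base (n : ℕ) (h : Y) : 𝕜 := (sumNorm e (2 ^ n) : 𝕜)⁻¹ * y.coord n (Γ.toX h)

/-- The coordinate functionals of the glued basis. -/
def coord (k : ℕ) : StrongDual 𝕜 Y :=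
  (sumNorm e (2 ^ level k) : 𝕜)⁻¹ • (y.coord (level k)).comp Γ.toX + (e.coord k).comp Γ.toS

theorem coord_apply (k : ℕ) (h : Y) :
    Γ.coord y k h = Γ.base y (level k) h + e.coord k (Γ.toS h) := rfl

theorem sumNorm_ne_zero (n : ℕ) : (sumNorm e (2 ^ n) : 𝕜) ≠ 0 :=
  RCLike.ofReal_ne_zero.2 (sumNorm_pos e (by positivity)).ne'

/-- For indices of the same level, subtracting the average contributes `-1 / 2 ^ level j`; the
weight is chosen so that the part from `X` restores exactly this amount. -/
theorem coord_vec (i j : ℕ) : Γ.coord y i (Γ.vec y j) = if i = j then 1 else 0 := by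
  have h1 : Γ.toX (Γ.vec y j) = (weight e j : 𝕜) • y (level j) := by
    simp [vec, Γ.toX_inX, Γ.toX_inS]
  have h2 : Γ.toS (Γ.vec y j) = e j - Γ.avg (e j) := by
    simp [vec, Γ.toS_inX, Γ.toS_inS]
  rw [coord_apply, base, h1, h2, map_sub, Γ.avg_basis, map_smul, map_smul, map_sum]
  simp only [coord_apply_basis, sum_ite_eq, mem_dyadic_block, smul_eq_mul, mul_ite, mul_one,
    mul_zero]
  have h3 : (sumNorm e (2 ^ level j) : 𝕜)⁻¹ * weight e j = (2 ^ level j)⁻¹ := by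
    have := sumNorm_ne_zero (e := e) (level j)
    rw [weight]
    push_cast
    field_simp
  by_cases h : level i = level j
  · rw [if_pos h, if_pos h, h, h3]
    ring
  · rw [if_neg h, if_neg h]
    ring

/-- Both cross terms vanish, since the vectors `inS (e k)` and the coordinates of `toS h` sum to
zero over a level. Projecting onto a whole level thus acts separately on the two summands. -/
theorem sum_levelSet (n : ℕ) (h : Y) : ∑ k ∈ levelSet n, Γ.coord y k h • Γ.vec y k =
    Γ.inX (y.coord n (Γ.toX h) • y n) +
      Γ.inS (∑ k ∈ levelSet n, e.coord k (Γ.toS h) • e k) := by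
  have h1 : ∑ k ∈ levelSet n, Γ.coord y k h • Γ.vec y k =
      (∑ k ∈ levelSet n, Γ.coord y k h) •
        ((sumNorm e (2 ^ n) / 2 ^ n : ℝ) : 𝕜) • Γ.inX (y n) +
      (Γ.base y n h • ∑ k ∈ levelSet n, Γ.inS (e k) +
        Γ.inS (∑ k ∈ levelSet n, e.coord k (Γ.toS h) • e k)) := by
    rw [sum_smul, smul_sum, map_sum, ← sum_add_distrib, ← sum_add_distrib]
    refine sum_congr rfl fun k hk => ?_
    rw [vec, weight, coord_apply, mem_levelSet.1 hk, map_smul]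
    module
  rw [h1, Γ.sum_inS, smul_zero, zero_add, map_smul]
  congr 1
  rw [smul_smul]
  congr 1
  rw [sum_congr rfl fun k hk => by rw [coord_apply, mem_levelSet.1 hk], sum_add_distrib,
    Γ.sum_coord_toS, add_zero, sum_const, card_levelSet, base, nsmul_eq_mul]
  have := sumNorm_ne_zero (e := e) n
  push_cast
  field_simp

theorem sum_range_pow (r : ℕ) (h : Y) :
    ∑ k ∈ range (2 ^ r - 1), Γ.coord y k h • Γ.vec y k =
      Γ.inX (y.proj r (Γ.toX h)) + Γ.inS (e.proj (2 ^ r - 1) (Γ.toS h)) := by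
  rw [SchauderBasis.proj_apply, SchauderBasis.proj_apply, sum_range_levels, sum_range_levels,
    map_sum, map_sum, ← sum_add_distrib]
  exact sum_congr rfl fun n _ => Γ.sum_levelSet y n h

variable {y} {K C : ℝ}

/-- Nothing but boundedness is asked of `y`, so its part is estimated by the triangle inequality,
that is, by a weighted `ℓ₁` sum. -/
theorem norm_sum_vec_le (hy : ∀ n, ‖y n‖ ≤ C ∧ ‖y.coord n‖ ≤ C) (D : Finset ℕ) (c : ℕ → 𝕜) :
    ‖∑ k ∈ D, c k • Γ.vec y k‖ ≤
      (‖Γ.inX‖ * C) * (∑ k ∈ D, ‖c k‖ * weight e k) + ‖Γ.inS‖ * ‖∑ k ∈ D, c k • e k‖ := by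
  have h1 : ∑ k ∈ D, c k • Γ.vec y k =
      ∑ k ∈ D, c k • (weight e k : 𝕜) • Γ.inX (y (level k)) + Γ.inS (∑ k ∈ D, c k • e k) := by
    rw [map_sum, ← sum_add_distrib]
    refine sum_congr rfl fun k _ => ?_
    rw [vec, smul_add, map_smul]
  rw [h1]
  refine (norm_add_le _ _).trans (add_le_add ?_ (Γ.inS.le_opNorm _))
  refine (norm_sum_le _ _).trans ?_
  rw [mul_sum]
  refine sum_le_sum fun k _ => ?_
  have h2 := (Γ.inX.le_opNorm (y (level k))).trans
    (mul_le_mul_of_nonneg_left (hy _).1 (norm_nonneg _))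
  rw [norm_smul, norm_smul, RCLike.norm_of_nonneg (weight_nonneg e k)]
  calc _ = (‖c k‖ * weight e k) * ‖Γ.inX (y (level k))‖ := by ring
    _ ≤ (‖c k‖ * weight e k) * (‖Γ.inX‖ * C) := by
        have := weight_nonneg e k
        gcongr
    _ = _ := by ring

theorem norm_base_mul (n : ℕ) (h : Y) :
    ‖Γ.base y n h‖ * sumNorm e (2 ^ n) = ‖y.coord n (Γ.toX h)‖ := by
  have hpos := sumNorm_pos e (show 0 < 2 ^ n by positivity)
  rw [base, norm_mul, norm_inv, RCLike.norm_of_nonneg hpos.le]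
  field_simp

/-- Coordinate projections inside a level. -/
theorem norm_sum_level_le (hK : Spreading e K) (hy : ∀ n, ‖y n‖ ≤ C ∧ ‖y.coord n‖ ≤ C) :
    ∃ M : ℝ, 0 < M ∧ ∀ (n : ℕ) (D : Finset ℕ) (h : Y), D ⊆ levelSet n →
      ‖∑ k ∈ D, Γ.coord y k h • Γ.vec y k‖ ≤ M * (‖y.coord n (Γ.toX h)‖ +
        ‖∑ k ∈ levelSet n, e.coord k (Γ.toS h) • e k‖) := by
  have h0 := hK.pos
  have hC : 0 ≤ C := (norm_nonneg _).trans (hy 0).1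
  refine ⟨(‖Γ.inX‖ * C) * (1 + 2 * K ^ 4) + ‖Γ.inS‖ * (K ^ 2 + K) + 1, by positivity,
    fun n D h hD => ?_⟩
  set β := ‖y.coord n (Γ.toX h)‖ with hβ
  set Q := ‖∑ k ∈ levelSet n, e.coord k (Γ.toS h) • e k‖ with hQ
  have hβ0 : 0 ≤ β := norm_nonneg _
  have hQ0 : 0 ≤ Q := norm_nonneg _
  have hpos := sumNorm_pos e (show 0 < 2 ^ n by positivity)
  have hw : ∀ k ∈ levelSet n, weight e k = sumNorm e (2 ^ n) / 2 ^ n := fun k hk => by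
    rw [weight, mem_levelSet.1 hk]
  have hbase : ‖Γ.base y n h‖ * sumNorm e (2 ^ n) = β := Γ.norm_base_mul n h
  -- On a single level the weight is constant, and the averaging inequality turns the `ℓ₁` sum of
  -- the coordinates into their norm in `S`.
  have h1 : ∑ k ∈ D, ‖Γ.coord y k h‖ * weight e k ≤ β + 2 * K ^ 4 * Q := by
    calc _ ≤ ∑ k ∈ levelSet n, ‖Γ.coord y k h‖ * weight e k :=
          sum_le_sum_of_subset_of_nonneg hD fun k _ _ =>
            mul_nonneg (norm_nonneg _) (weight_nonneg e k)
      _ ≤ ∑ k ∈ levelSet n, (‖Γ.base y n h‖ + ‖e.coord k (Γ.toS h)‖) *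
          (sumNorm e (2 ^ n) / 2 ^ n) := by
          refine sum_le_sum fun k hk => ?_
          rw [hw k hk, coord_apply, mem_levelSet.1 hk]
          gcongr
          exact norm_add_le _ _
      _ = ‖Γ.base y n h‖ * sumNorm e (2 ^ n) +
          (∑ k ∈ levelSet n, ‖e.coord k (Γ.toS h)‖) * sumNorm e (2 ^ n) / 2 ^ n := by
          rw [← sum_mul, sum_add_distrib, sum_const, card_levelSet, nsmul_eq_mul]
          push_cast
          field_simp
      _ ≤ β + 2 * K ^ 4 * Q := by
          rw [hbase]
          gcongr
          rw [div_le_iff₀ (by positivity)]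
          have := hK.sum_norm_le (levelSet n) fun k => e.coord k (Γ.toS h)
          rw [card_levelSet] at this
          push_cast at this
          linarith
  have h2 : ‖∑ k ∈ D, Γ.coord y k h • e k‖ ≤ K ^ 2 * β + K * Q := by
    have h3 : ∑ k ∈ D, Γ.coord y k h • e k =
        Γ.base y n h • ∑ k ∈ D, e k + ∑ k ∈ D, e.coord k (Γ.toS h) • e k := by
      rw [smul_sum, ← sum_add_distrib]
      refine sum_congr rfl fun k hk => ?_
      rw [coord_apply, mem_levelSet.1 (hD hk), add_smul]
    have h4 : ‖∑ k ∈ D, e k‖ ≤ K ^ 2 * sumNorm e (2 ^ n) := by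
      have h5 := hK.subset D _ (fun _ => 1) hD
      have h6 := hK.norm_sum_le_sumNorm (levelSet n)
      rw [card_levelSet] at h6
      simp only [one_smul] at h5
      calc _ ≤ K * (K * sumNorm e (2 ^ n)) := h5.trans (by gcongr)
        _ = _ := by ring
    rw [h3]
    refine (norm_add_le _ _).trans (add_le_add ?_ (hK.subset D _ _ hD))
    rw [norm_smul]
    calc _ ≤ ‖Γ.base y n h‖ * (K ^ 2 * sumNorm e (2 ^ n)) := by gcongr
      _ = K ^ 2 * (‖Γ.base y n h‖ * sumNorm e (2 ^ n)) := by ring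
      _ = _ := by rw [hbase]
  have h3 : β + 2 * K ^ 4 * Q ≤ (1 + 2 * K ^ 4) * (β + Q) := by
    have := mul_nonneg (show 0 ≤ 2 * K ^ 4 by positivity) hβ0
    nlinarith
  have h4 : K ^ 2 * β + K * Q ≤ (K ^ 2 + K) * (β + Q) := by
    have := mul_nonneg (show 0 ≤ K ^ 2 by positivity) hQ0
    have := mul_nonneg h0.le hβ0
    nlinarith
  calc _ ≤ _ := Γ.norm_sum_vec_le hy D _
    _ ≤ (‖Γ.inX‖ * C) * ((1 + 2 * K ^ 4) * (β + Q)) +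
        ‖Γ.inS‖ * ((K ^ 2 + K) * (β + Q)) := by
        gcongr
        · exact h1.trans h3
        · exact h2.trans h4
    _ ≤ _ := by linarith [add_nonneg hβ0 hQ0]

/-- Along full levels the partial sums are those of `y` and `e`. An incomplete level is controlled
by one term of the expansion in `y` and one block of that in `e`, both of which tend to zero. -/
theorem tendsto_expansion (hK : Spreading e K) (hy : ∀ n, ‖y n‖ ≤ C ∧ ‖y.coord n‖ ≤ C)
    (h : Y) : Tendsto (fun n => ∑ k ∈ range n, Γ.coord y k h • Γ.vec y k) atTop (𝓝 h) := by
  have hC : 0 ≤ C := (norm_nonneg _).trans (hy 0).1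
  obtain ⟨M, hM, hlev⟩ := Γ.norm_sum_level_le hK hy
  have hpow : Tendsto (fun r : ℕ => 2 ^ r - 1) atTop atTop :=
    tendsto_atTop_mono (fun r => by
      have := Nat.lt_two_pow_self (n := r)
      simp only [id]; omega) tendsto_id
  refine tendsto_of_levels (N := fun r => 2 ^ r - 1) (ℓ := level) tendsto_level ?_ ?_
  · simp only [sum_range_pow]
    have h1 := (Γ.inX.continuous.tendsto _).comp (y.tendsto_proj (Γ.toX h))
    have h2 := (Γ.inS.continuous.tendsto _).comp ((e.tendsto_proj (Γ.toS h)).comp hpow)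
    have h3 := h1.add h2
    rw [Γ.inX_toX_add] at h3
    exact h3
  · intro ε hε
    have hδ : 0 < ε / (M * (C + 1)) := by positivity
    obtain ⟨N₁, hN₁⟩ := tail_small y (Γ.toX h) hδ
    obtain ⟨N₂, hN₂⟩ := tail_small e (Γ.toS h) hδ
    filter_upwards [tendsto_level.eventually_ge_atTop N₁,
      (hpow.comp tendsto_level).eventually_ge_atTop N₂] with n h1 h2
    simp only [Function.comp_apply] at h2
    have hspec := level_spec n
    rw [pow_succ] at hspec
    have hle : 2 ^ level n - 1 ≤ n := by omega
    rw [← sum_Ico_eq_sub _ hle]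
    have hsub : Ico (2 ^ level n - 1) n ⊆ levelSet (level n) :=
      Ico_subset_Ico_right (by rw [pow_succ]; omega)
    refine (hlev _ _ h hsub).trans ?_
    have h3 : ‖y.coord (level n) (Γ.toX h)‖ ≤ C * (ε / (M * (C + 1))) := by
      have h4 := hN₁ (level n) (level n + 1) h1
      rw [Nat.Ico_succ_singleton, sum_singleton] at h4
      -- The bound on the functional recovers the coefficient from the norm of the term, without a
      -- separate lower bound for `‖y n‖`.
      have h5 : y.coord (level n) (y.coord (level n) (Γ.toX h) • y (level n)) =
          y.coord (level n) (Γ.toX h) := by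
        rw [map_smul, coord_apply_basis, if_pos rfl, smul_eq_mul, mul_one]
      rw [← h5]
      exact ((y.coord (level n)).le_of_opNorm_le (hy _).2 _).trans (by gcongr)
    have h4 := hN₂ _ (2 ^ (level n + 1) - 1) h2
    calc _ ≤ M * (C * (ε / (M * (C + 1))) + ε / (M * (C + 1))) := by
          gcongr; exact h4
      _ = ε := by field_simp

/-- The glued basis. -/
def basis (hK : Spreading e K) (hy : ∀ n, ‖y n‖ ≤ C ∧ ‖y.coord n‖ ≤ C) : SchauderBasis 𝕜 Y :=
  mkBasis (Γ.vec y) (Γ.coord y) (Γ.coord_vec y) (Γ.tendsto_expansion hK hy)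

end Gluing

end Gluing

/-! ### Sums of weights. -/

section Weights

variable {𝕜 : Type*} [RCLike 𝕜] {S : Type*} [NormedAddCommGroup S] [NormedSpace 𝕜 S]
  {e : SchauderBasis 𝕜 S} {K : ℝ}

theorem Spreading.weight_mul_le (hK : Spreading e K) {r k : ℕ} (h : r ≤ level k) :
    weight e k * 2 ^ r ≤ 2 * K ^ 2 * sumNorm e (2 ^ r) := by
  have h1 := hK.sumNorm_mul_le (Nat.pow_le_pow_right two_pos h)
  push_cast at h1
  rw [weight, div_mul_eq_mul_div, div_le_iff₀ (by positivity)]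
  linarith

theorem Spreading.sumNorm_le_of_lt (hK : Spreading e K) {m r : ℕ} (h : m ≤ 2 * 2 ^ r) :
    sumNorm e m ≤ 4 * K ^ 3 * sumNorm e (2 ^ r) := by
  have h0 := hK.pos
  calc _ ≤ K * sumNorm e (2 * 2 ^ r) := hK.sumNorm_mono h
    _ ≤ K * (4 * K ^ 2 * sumNorm e (2 ^ r)) := by gcongr; exact hK.sumNorm_two_mul _
    _ = _ := by ring

/-- Let `2 ^ r` be the dyadic size of `D`. A whole level `n` has total weight `sumNorm e (2 ^ n)`,
so lower regularity handles the levels up to `r`; above, each of the at most `2 * 2 ^ r` weights is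
at most a multiple of `sumNorm e (2 ^ r) / 2 ^ r`. -/
theorem Spreading.sum_weight_le (hK : Spreading e K) {R : ℝ} (hR0 : 0 < R)
    (hR : ∀ r : ℕ, ∑ n ∈ range (r + 1), sumNorm e (2 ^ n) ≤ R * sumNorm e (2 ^ r))
    (D : Finset ℕ) : ∑ k ∈ D, weight e k ≤ (R * K + 4 * K ^ 3) * sumNorm e D.card := by
  have h0 := hK.pos
  rcases D.eq_empty_or_nonempty with rfl | hD
  · simpa using mul_nonneg (by positivity) (sumNorm_nonneg e 0)
  set r := Nat.log 2 D.card with hr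
  obtain ⟨h1, h2⟩ := (log_two_eq_iff hD.card_pos.ne').1 hr.symm
  have h3 : sumNorm e (2 ^ r) ≤ K * sumNorm e D.card := hK.sumNorm_mono h1
  rw [← sum_filter_add_sum_filter_not D fun k => level k ≤ r]
  have h4 : ∑ k ∈ D with level k ≤ r, weight e k ≤ R * sumNorm e (2 ^ r) := by
    refine le_trans ?_ (hR r)
    calc _ ≤ ∑ k ∈ range (2 ^ (r + 1) - 1), weight e k := by
          refine sum_le_sum_of_subset_of_nonneg (fun k hk => ?_) fun k _ _ => weight_nonneg e k
          have h5 := Nat.pow_le_pow_right two_pos (Nat.succ_le_succ (mem_filter.1 hk).2)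
          have h6 := (level_spec k).2
          simp only [Nat.succ_eq_add_one] at h5
          rw [mem_range]; omega
      _ = _ := by
          rw [sum_range_levels]
          refine sum_congr rfl fun n _ => ?_
          rw [sum_congr rfl fun k hk => by rw [weight, mem_levelSet.1 hk], sum_const,
            card_levelSet, nsmul_eq_mul]
          push_cast
          field_simp
  have h5 : ∑ k ∈ D with ¬ level k ≤ r, weight e k ≤ 4 * K ^ 2 * sumNorm e (2 ^ r) := by
    have h6 : ∀ k ∈ D.filter fun k => ¬ level k ≤ r,
        weight e k ≤ 2 * K ^ 2 * sumNorm e (2 ^ r) / 2 ^ r := fun k hk => by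
      rw [le_div_iff₀ (by positivity)]
      exact hK.weight_mul_le (not_le.1 (mem_filter.1 hk).2).le
    have h7 : ((D.filter fun k => ¬ level k ≤ r).card : ℝ) ≤ 2 * 2 ^ r := by
      have h8 := card_filter_le D fun k => ¬ level k ≤ r
      have h9 : (D.filter fun k => ¬ level k ≤ r).card ≤ 2 * 2 ^ r := by
        rw [pow_succ] at h2; omega
      exact_mod_cast h9
    have h10 := sumNorm_nonneg e (2 ^ r)
    calc _ ≤ _ := sum_le_sum h6
      _ = ((D.filter fun k => ¬ level k ≤ r).card : ℝ) *
          (2 * K ^ 2 * sumNorm e (2 ^ r) / 2 ^ r) := by rw [sum_const, nsmul_eq_mul]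
      _ ≤ 2 * 2 ^ r * (2 * K ^ 2 * sumNorm e (2 ^ r) / 2 ^ r) := by gcongr
      _ = _ := by field_simp; ring
  calc _ ≤ (R + 4 * K ^ 2) * sumNorm e (2 ^ r) := by linarith
    _ ≤ (R + 4 * K ^ 2) * (K * sumNorm e D.card) := by gcongr
    _ = _ := by ring

end Weights

/-! ### Democracy and quasi-greediness of the glued basis. -/

namespace Gluing

section Estimates

variable {𝕜 : Type*} [RCLike 𝕜] {S : Type*} [NormedAddCommGroup S] [NormedSpace 𝕜 S]
  {X : Type*} [NormedAddCommGroup X] [NormedSpace 𝕜 X]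
  {Y : Type*} [NormedAddCommGroup Y] [NormedSpace 𝕜 Y]
  {e : SchauderBasis 𝕜 S} (Γ : Gluing e X Y) {y : SchauderBasis 𝕜 X} {K C R : ℝ}

/-- Upper democracy estimate. -/
theorem exists_upper (hK : Spreading e K) (hy : ∀ n, ‖y n‖ ≤ C ∧ ‖y.coord n‖ ≤ C) (hR0 : 0 < R)
    (hR : ∀ r : ℕ, ∑ n ∈ range (r + 1), sumNorm e (2 ^ n) ≤ R * sumNorm e (2 ^ r)) :
    ∃ M : ℝ, 0 < M ∧ ∀ (D : Finset ℕ) (c : ℕ → 𝕜) (t : ℝ), 0 ≤ t → (∀ k ∈ D, ‖c k‖ ≤ t) →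
      ‖∑ k ∈ D, c k • Γ.vec y k‖ ≤ M * (t * sumNorm e D.card) := by
  have h0 := hK.pos
  have hC : 0 ≤ C := (norm_nonneg _).trans (hy 0).1
  refine ⟨(‖Γ.inX‖ * C) * (R * K + 4 * K ^ 3) + ‖Γ.inS‖ * K ^ 2 + 1, by positivity,
    fun D c t ht hc => ?_⟩
  have h1 : ∑ k ∈ D, ‖c k‖ * weight e k ≤ t * ((R * K + 4 * K ^ 3) * sumNorm e D.card) := by
    calc _ ≤ ∑ k ∈ D, t * weight e k := sum_le_sum fun k hk =>
          mul_le_mul_of_nonneg_right (hc k hk) (weight_nonneg e k)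
      _ = t * ∑ k ∈ D, weight e k := by rw [mul_sum]
      _ ≤ _ := by gcongr; exact hK.sum_weight_le hR0 hR D
  have h2 := hK.norm_sum_le_of_le hc ht
  calc _ ≤ _ := Γ.norm_sum_vec_le hy D c
    _ ≤ (‖Γ.inX‖ * C) * (t * ((R * K + 4 * K ^ 3) * sumNorm e D.card)) +
        ‖Γ.inS‖ * (K ^ 2 * (t * sumNorm e D.card)) := by gcongr
    _ ≤ _ := by linarith [mul_nonneg ht (sumNorm_nonneg e D.card)]

theorem norm_base_le (hy : ∀ n, ‖y n‖ ≤ C ∧ ‖y.coord n‖ ≤ C) (n : ℕ) (h : Y) :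
    ‖Γ.base y n h‖ * sumNorm e (2 ^ n) ≤ C * ‖Γ.toX‖ * ‖h‖ := by
  have hC : 0 ≤ C := (norm_nonneg _).trans (hy 0).1
  rw [norm_base_mul, mul_assoc]
  exact ((y.coord n).le_of_opNorm_le (hy n).2 _).trans
    (mul_le_mul_of_nonneg_left (Γ.toX.le_opNorm h) hC)

/-- Lower democracy estimate. -/
theorem exists_lower (hK : Spreading e K) (hy : ∀ n, ‖y n‖ ≤ C ∧ ‖y.coord n‖ ≤ C) :
    ∃ M : ℝ, 0 < M ∧ ∀ (h : Y) (G : Finset ℕ) (t : ℝ), 0 ≤ t →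
      (∀ k ∈ G, t ≤ ‖Γ.coord y k h‖) → t * sumNorm e G.card ≤ M * ‖h‖ := by
  have h0 := hK.pos
  have hC : 0 ≤ C := (norm_nonneg _).trans (hy 0).1
  refine ⟨K * (K * (2 * K ^ 3 * ‖Γ.toS‖) + K * (8 * K ^ 3 * (C * ‖Γ.toX‖))) + 1,
    by positivity, fun h G t ht hG => ?_⟩
  -- Each coefficient of modulus at least `t` owes at least `t / 2` to one of its two parts.
  set G₁ := G.filter fun k => t / 2 ≤ ‖e.coord k (Γ.toS h)‖ with hG₁
  set G₂ := G.filter fun k => ¬ t / 2 ≤ ‖e.coord k (Γ.toS h)‖ with hG₂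
  have h1 : t * sumNorm e G₁.card ≤ 2 * K ^ 3 * ‖Γ.toS‖ * ‖h‖ := by
    have h2 := hK.le_norm_sum_of_le (A := G₁) (a := fun k => e.coord k (Γ.toS h)) (t := t / 2)
      (fun k hk => (mem_filter.1 hk).2) (by positivity)
    have h3 := (hK.proj G₁ (Γ.toS h)).trans
      (mul_le_mul_of_nonneg_left (Γ.toS.le_opNorm h) h0.le)
    have h4 := mul_le_mul_of_nonneg_left h3 (show 0 ≤ K ^ 2 by positivity)
    nlinarith
  have h2 : t * sumNorm e G₂.card ≤ 8 * K ^ 3 * (C * ‖Γ.toX‖) * ‖h‖ := by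
    rcases G₂.eq_empty_or_nonempty with h3 | h3
    · rw [h3, card_empty]
      have : sumNorm e 0 = 0 := by simp [sumNorm]
      rw [this, mul_zero]
      positivity
    -- One index of highest level suffices: its common coefficient is bounded through `sumNorm e (2
    -- ^ level k)`, while `G₂` has fewer than `2 * 2 ^ level k` elements.
    obtain ⟨k, hk, hmax⟩ := exists_max_image G₂ level h3
    have h4 : t / 2 ≤ ‖Γ.base y (level k) h‖ := by
      have h5 := hG k (mem_filter.1 hk).1
      have h6 := not_le.1 (mem_filter.1 hk).2
      rw [coord_apply] at h5
      have h7 := norm_add_le (Γ.base y (level k) h) (e.coord k (Γ.toS h))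
      linarith
    have h5 : G₂.card ≤ 2 * 2 ^ level k := by
      have h6 : G₂ ⊆ range (2 * 2 ^ level k) := fun j hj => by
        have h7 := Nat.pow_le_pow_right two_pos (Nat.succ_le_succ (hmax j hj))
        have h8 := (level_spec j).2
        simp only [Nat.succ_eq_add_one, pow_succ] at h7 h8
        rw [mem_range]; omega
      simpa using card_le_card h6
    have h6 := hK.sumNorm_le_of_lt h5
    have h7 := Γ.norm_base_le hy (level k) h
    have h8 : t / 2 * sumNorm e (2 ^ level k) ≤ C * ‖Γ.toX‖ * ‖h‖ :=
      le_trans (mul_le_mul_of_nonneg_right h4 (sumNorm_nonneg _ _)) h7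
    calc _ ≤ t * (4 * K ^ 3 * sumNorm e (2 ^ level k)) := by gcongr
      _ = 8 * K ^ 3 * (t / 2 * sumNorm e (2 ^ level k)) := by ring
      _ ≤ 8 * K ^ 3 * (C * ‖Γ.toX‖ * ‖h‖) := by gcongr
      _ = _ := by ring
  have h3 : sumNorm e G.card ≤ K * (K * sumNorm e G₁.card + K * sumNorm e G₂.card) := by
    refine (hK.sumNorm_le_norm_sum G).trans ?_
    gcongr
    rw [← sum_filter_add_sum_filter_not G fun k => t / 2 ≤ ‖e.coord k (Γ.toS h)‖]
    exact (norm_add_le _ _).trans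
      (add_le_add (hK.norm_sum_le_sumNorm _) (hK.norm_sum_le_sumNorm _))
  calc _ ≤ t * (K * (K * sumNorm e G₁.card + K * sumNorm e G₂.card)) := by gcongr
    _ = K * (K * (t * sumNorm e G₁.card) + K * (t * sumNorm e G₂.card)) := by ring
    _ ≤ K * (K * (2 * K ^ 3 * ‖Γ.toS‖ * ‖h‖) + K * (8 * K ^ 3 * (C * ‖Γ.toX‖) * ‖h‖)) := by
        gcongr
    _ ≤ _ := by linarith [norm_nonneg h]

theorem exists_norm_initial_le [CompleteSpace X] (hK : Spreading e K) :
    ∃ M : ℝ, 0 < M ∧ ∀ (r : ℕ) (h : Y),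
      ‖∑ k ∈ range (2 ^ r - 1), Γ.coord y k h • Γ.vec y k‖ ≤ M * ‖h‖ := by
  obtain ⟨P, hP⟩ := y.exists_norm_proj_le
  have hP0 : 0 ≤ P := (norm_nonneg _).trans (hP 0)
  have h0 := hK.pos
  refine ⟨‖Γ.inX‖ * (P * ‖Γ.toX‖) + ‖Γ.inS‖ * (K * ‖Γ.toS‖) + 1, by positivity, fun r h => ?_⟩
  rw [sum_range_pow]
  have h1 : ‖y.proj r (Γ.toX h)‖ ≤ P * (‖Γ.toX‖ * ‖h‖) :=
    ((y.proj r).le_of_opNorm_le (hP r) _).trans (by gcongr; exact Γ.toX.le_opNorm h)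
  have h2 : ‖e.proj (2 ^ r - 1) (Γ.toS h)‖ ≤ K * (‖Γ.toS‖ * ‖h‖) := by
    rw [SchauderBasis.proj_apply]
    exact (hK.proj _ _).trans (by gcongr; exact Γ.toS.le_opNorm h)
  calc _ ≤ _ := norm_add_le _ _
    _ ≤ ‖Γ.inX‖ * (P * (‖Γ.toX‖ * ‖h‖)) + ‖Γ.inS‖ * (K * (‖Γ.toS‖ * ‖h‖)) :=
        add_le_add (Γ.inX.le_opNorm_of_le h1) (Γ.inS.le_opNorm_of_le h2)
    _ ≤ _ := by linarith [norm_nonneg h]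

/-- Coordinate projections onto sets of indices of high level, in terms of a set of
comparable cardinality. -/
theorem exists_high_level (hK : Spreading e K) (hy : ∀ n, ‖y n‖ ≤ C ∧ ‖y.coord n‖ ≤ C) :
    ∃ M : ℝ, 0 < M ∧ ∀ (h : Y) (G D : Finset ℕ) (r : ℕ), D ⊆ G → 2 ^ r ≤ G.card →
      G.card ≤ 2 * 2 ^ r → (∀ k ∈ D, r ≤ level k) →
      ‖∑ k ∈ D, Γ.coord y k h • Γ.vec y k‖ ≤ M * ‖h‖ := by
  have h0 := hK.pos
  have hC : 0 ≤ C := (norm_nonneg _).trans (hy 0).1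
  refine ⟨(‖Γ.inX‖ * C) * (2 * (C * ‖Γ.toX‖) + 8 * K ^ 8 * ‖Γ.toS‖) +
    ‖Γ.inS‖ * (4 * K ^ 6 * (C * ‖Γ.toX‖) + K * ‖Γ.toS‖) + 1, by positivity,
    fun h G D r hDG hr1 hr2 hD => ?_⟩
  have hpos := sumNorm_pos e (show 0 < 2 ^ r by positivity)
  have hDc : (D.card : ℝ) ≤ 2 * 2 ^ r := by
    exact_mod_cast (card_le_card hDG).trans hr2
  have hGc : (G.card : ℝ) ≤ 2 * 2 ^ r := by exact_mod_cast hr2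
  set B := C * ‖Γ.toX‖ * ‖h‖ with hB
  have hB0 : 0 ≤ B := by positivity
  set q := fun k => e.coord k (Γ.toS h) with hq
  -- The sum is enlarged from `D` to `G`, whose cardinality is of order `2 ^ r`, as the bound for
  -- the weights requires.
  have hqG : ∑ k ∈ D, ‖q k‖ * weight e k ≤ 8 * K ^ 8 * ‖Γ.toS‖ * ‖h‖ := by
    have h1 : ∑ k ∈ D, ‖q k‖ * weight e k ≤
        (∑ k ∈ G, ‖q k‖) * (2 * K ^ 2 * sumNorm e (2 ^ r) / 2 ^ r) := by
      rw [sum_mul]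
      calc _ ≤ ∑ k ∈ D, ‖q k‖ * (2 * K ^ 2 * sumNorm e (2 ^ r) / 2 ^ r) := by
            refine sum_le_sum fun k hk => ?_
            gcongr
            rw [le_div_iff₀ (by positivity)]
            exact hK.weight_mul_le (hD k hk)
        _ ≤ _ := sum_le_sum_of_subset_of_nonneg hDG fun k _ _ => by positivity
    have h2 := hK.sum_norm_le G q
    have h3 : ‖∑ k ∈ G, q k • e k‖ ≤ K * (‖Γ.toS‖ * ‖h‖) :=
      (hK.proj G (Γ.toS h)).trans (by gcongr; exact Γ.toS.le_opNorm h)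
    have h4 : (∑ k ∈ G, ‖q k‖) * sumNorm e (2 ^ r) ≤
        K * (2 * K ^ 4 * (2 * 2 ^ r * (K * (‖Γ.toS‖ * ‖h‖)))) := by
      calc _ ≤ (∑ k ∈ G, ‖q k‖) * (K * sumNorm e G.card) := by
            gcongr; exact hK.sumNorm_mono hr1
        _ = K * ((∑ k ∈ G, ‖q k‖) * sumNorm e G.card) := by ring
        _ ≤ K * (2 * K ^ 4 * (G.card * ‖∑ k ∈ G, q k • e k‖)) := by gcongr
        _ ≤ _ := by gcongr
    calc _ ≤ _ := h1
      _ = 2 * K ^ 2 * ((∑ k ∈ G, ‖q k‖) * sumNorm e (2 ^ r)) / 2 ^ r := by ring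
      _ ≤ 2 * K ^ 2 * (K * (2 * K ^ 4 * (2 * 2 ^ r * (K * (‖Γ.toS‖ * ‖h‖))))) / 2 ^ r := by
          gcongr
      _ = _ := by field_simp; ring
  -- In each product `sumNorm` cancels, leaving at most `B / 2 ^ level k`, for at most `2 * 2 ^ r`
  -- indices of level at least `r`.
  have hβ : ∑ k ∈ D, ‖Γ.base y (level k) h‖ * weight e k ≤ 2 * B := by
    have h1 : ∀ k ∈ D, ‖Γ.base y (level k) h‖ * weight e k ≤ B / 2 ^ r := fun k hk => by
      rw [weight, ← mul_div_assoc]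
      have h2 := Γ.norm_base_le hy (level k) h
      have h3 : (2 : ℝ) ^ r ≤ 2 ^ level k := pow_le_pow_right₀ one_le_two (hD k hk)
      gcongr
    calc _ ≤ _ := sum_le_sum h1
      _ = D.card * (B / 2 ^ r) := by rw [sum_const, nsmul_eq_mul]
      _ ≤ 2 * 2 ^ r * (B / 2 ^ r) := by gcongr
      _ = _ := by field_simp
  have h1 : ∑ k ∈ D, ‖Γ.coord y k h‖ * weight e k ≤ 2 * B + 8 * K ^ 8 * ‖Γ.toS‖ * ‖h‖ := by
    refine le_trans ?_ (add_le_add hβ hqG)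
    rw [← sum_add_distrib]
    refine sum_le_sum fun k _ => ?_
    rw [← add_mul, coord_apply]
    exact mul_le_mul_of_nonneg_right (norm_add_le _ _) (weight_nonneg e k)
  have h2 : ‖∑ k ∈ D, Γ.coord y k h • e k‖ ≤ 4 * K ^ 6 * B + K * (‖Γ.toS‖ * ‖h‖) := by
    have h3 : ∑ k ∈ D, Γ.coord y k h • e k =
        ∑ k ∈ D, Γ.base y (level k) h • e k + ∑ k ∈ D, q k • e k := by
      rw [← sum_add_distrib]
      exact sum_congr rfl fun k _ => by rw [coord_apply, add_smul]
    rw [h3]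
    refine (norm_add_le _ _).trans (add_le_add ?_ ?_)
    · have h4 : ∀ k ∈ D, ‖Γ.base y (level k) h‖ ≤ K * B / sumNorm e (2 ^ r) := fun k hk => by
        rw [le_div_iff₀ hpos]
        calc _ ≤ ‖Γ.base y (level k) h‖ * (K * sumNorm e (2 ^ level k)) := by
              gcongr
              exact hK.sumNorm_mono (Nat.pow_le_pow_right two_pos (hD k hk))
          _ = K * (‖Γ.base y (level k) h‖ * sumNorm e (2 ^ level k)) := by ring
          _ ≤ _ := by gcongr; exact Γ.norm_base_le hy (level k) h
      calc _ ≤ _ := hK.norm_sum_le_of_le h4 (by positivity)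
        _ ≤ K ^ 2 * (K * B / sumNorm e (2 ^ r) * (4 * K ^ 3 * sumNorm e (2 ^ r))) := by
            gcongr
            exact hK.sumNorm_le_of_lt ((card_le_card hDG).trans hr2)
        _ = _ := by field_simp
    · exact (hK.proj D (Γ.toS h)).trans (by gcongr; exact Γ.toS.le_opNorm h)
  calc _ ≤ _ := Γ.norm_sum_vec_le hy D _
    _ ≤ (‖Γ.inX‖ * C) * (2 * B + 8 * K ^ 8 * ‖Γ.toS‖ * ‖h‖) +
        ‖Γ.inS‖ * (4 * K ^ 6 * B + K * (‖Γ.toS‖ * ‖h‖)) := by gcongr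
    _ ≤ _ := by rw [hB]; linarith [norm_nonneg h]

/-- The glued basis is quasi-greedy. -/
theorem exists_quasiGreedy [CompleteSpace X] (hK : Spreading e K)
    (hy : ∀ n, ‖y n‖ ≤ C ∧ ‖y.coord n‖ ≤ C) (hR0 : 0 < R)
    (hR : ∀ r : ℕ, ∑ n ∈ range (r + 1), sumNorm e (2 ^ n) ≤ R * sumNorm e (2 ^ r)) :
    ∃ M : ℝ, 0 < M ∧ ∀ (h : Y) (G : Finset ℕ),
      (∀ j ∉ G, ∀ k ∈ G, ‖Γ.coord y j h‖ ≤ ‖Γ.coord y k h‖) →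
      ‖∑ k ∈ G, Γ.coord y k h • Γ.vec y k‖ ≤ M * ‖h‖ := by
  have h0 := hK.pos
  obtain ⟨M₁, hM₁, hup⟩ := Γ.exists_upper hK hy hR0 hR
  obtain ⟨M₂, hM₂, hlow⟩ := Γ.exists_lower hK hy
  obtain ⟨M₃, hM₃, hinit⟩ := Γ.exists_norm_initial_le (y := y) hK
  obtain ⟨M₄, hM₄, hhigh⟩ := Γ.exists_high_level hK hy
  refine ⟨M₃ + M₁ * (4 * K ^ 4 * M₂) + M₄, by positivity, fun h G hG => ?_⟩
  rcases G.eq_empty_or_nonempty with rfl | hne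
  · simp only [sum_empty, norm_zero]; positivity
  obtain ⟨k₀, hk₀, hmin⟩ := exists_min_image G (fun k => ‖Γ.coord y k h‖) hne
  set t := ‖Γ.coord y k₀ h‖ with ht
  have ht0 : 0 ≤ t := norm_nonneg _
  have hl := hlow h G t ht0 hmin
  set r := Nat.log 2 G.card with hr
  obtain ⟨hr1, hr2⟩ := (log_two_eq_iff hne.card_pos.ne').1 hr.symm
  rw [pow_succ'] at hr2
  set I := range (2 ^ (r + 1) - 1) with hI
  have hpos : 0 < 2 ^ r := by positivity
  -- The segment `I` consists of all levels up to `r` and has size comparable to `G`. Its projection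
  -- is bounded; on `I \ G` the coefficients are at most the minimum `t` on `G`, so democracy
  -- applies; `G \ I` has only high levels.
  have h1 : ∑ k ∈ G, Γ.coord y k h • Γ.vec y k =
      ∑ k ∈ I, Γ.coord y k h • Γ.vec y k - ∑ k ∈ I \ G, Γ.coord y k h • Γ.vec y k +
        ∑ k ∈ G \ I, Γ.coord y k h • Γ.vec y k := by
    have h2 := sum_inter_add_sum_sdiff I G fun k => Γ.coord y k h • Γ.vec y k
    have h3 := sum_inter_add_sum_sdiff G I fun k => Γ.coord y k h • Γ.vec y k
    rw [inter_comm] at h3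
    rw [← h2, ← h3]
    abel
  have h2 : ‖∑ k ∈ I \ G, Γ.coord y k h • Γ.vec y k‖ ≤ M₁ * (4 * K ^ 4 * (M₂ * ‖h‖)) := by
    have h3 := hup (I \ G) (fun k => Γ.coord y k h) t ht0 fun k hk =>
      hG k (mem_sdiff.1 hk).2 k₀ hk₀
    have h4 : (I \ G).card ≤ 2 * 2 ^ r := by
      refine (card_le_card sdiff_subset).trans ?_
      rw [hI, card_range, pow_succ]; omega
    have h5 : t * sumNorm e (I \ G).card ≤ 4 * K ^ 4 * (M₂ * ‖h‖) := by
      calc _ ≤ t * (4 * K ^ 3 * (K * sumNorm e G.card)) := by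
            gcongr
            exact (hK.sumNorm_le_of_lt h4).trans (by gcongr; exact hK.sumNorm_mono hr1)
        _ = 4 * K ^ 4 * (t * sumNorm e G.card) := by ring
        _ ≤ _ := by gcongr
    exact h3.trans (by gcongr)
  have h3 := hhigh h G (G \ I) r sdiff_subset hr1 hr2.le fun k hk => by
    have h4 := (mem_sdiff.1 hk).2
    rw [hI, mem_range, not_lt, pow_succ] at h4
    by_contra! h5
    have h6 := (level_spec k).2
    have h7 : 2 ^ (level k + 1) ≤ 2 ^ r := Nat.pow_le_pow_right two_pos h5
    omega
  rw [h1]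
  refine (norm_add_le _ _).trans ((add_le_add (norm_sub_le _ _) le_rfl).trans ?_)
  have h4 := hinit (r + 1) h
  calc _ ≤ M₃ * ‖h‖ + M₁ * (4 * K ^ 4 * (M₂ * ‖h‖)) + M₄ * ‖h‖ :=
        add_le_add (add_le_add h4 h2) h3
    _ = _ := by ring

end Estimates

end Gluing

/-! ### Almost greediness, fundamental function and conditionality. -/

namespace Gluing

section Main

variable {𝕜 : Type*} [RCLike 𝕜] {S : Type*} [NormedAddCommGroup S] [NormedSpace 𝕜 S]
  {X : Type*} [NormedAddCommGroup X] [NormedSpace 𝕜 X]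
  {Y : Type*} [NormedAddCommGroup Y] [NormedSpace 𝕜 Y]
  {e : SchauderBasis 𝕜 S} (Γ : Gluing e X Y) {y : SchauderBasis 𝕜 X} {K C R : ℝ}

theorem proj_basis (hK : Spreading e K) (hy : ∀ n, ‖y n‖ ≤ C ∧ ‖y.coord n‖ ≤ C)
    (A : Finset ℕ) (f : Y) : GeneralSchauderBasis.proj (Γ.basis hK hy) A f =
      ∑ k ∈ A, Γ.coord y k f • Γ.vec y k :=
  GeneralSchauderBasis.proj_apply _ _ _

theorem sum_vec_eq (A : Finset ℕ) :
    ∑ k ∈ A, Γ.vec y k = ∑ k ∈ A, (1 : 𝕜) • Γ.vec y k := by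
  simp

theorem coord_sum_vec (A : Finset ℕ) {k : ℕ} (hk : k ∈ A) :
    Γ.coord y k (∑ j ∈ A, Γ.vec y j) = 1 := by
  rw [map_sum]
  simp [coord_vec, hk]

theorem semiNormalized (hK : Spreading e K) (hy : ∀ n, ‖y n‖ ≤ C ∧ ‖y.coord n‖ ≤ C)
    (hR0 : 0 < R)
    (hR : ∀ r : ℕ, ∑ n ∈ range (r + 1), sumNorm e (2 ^ n) ≤ R * sumNorm e (2 ^ r)) :
    SemiNormalized (Γ.basis hK hy) := by
  obtain ⟨M₁, hM₁, hup⟩ := Γ.exists_upper hK hy hR0 hR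
  obtain ⟨M₂, hM₂, hlow⟩ := Γ.exists_lower hK hy
  have hpos : 0 < sumNorm e 1 := sumNorm_pos e one_pos
  refine ⟨sumNorm e 1 / M₂, M₁ * sumNorm e 1, by positivity, fun j => ?_⟩
  change _ ≤ ‖Γ.vec y j‖ ∧ ‖Γ.vec y j‖ ≤ _
  constructor
  · rw [div_le_iff₀' hM₂]
    have := hlow (Γ.vec y j) {j} 1 zero_le_one (by simp [coord_vec])
    simpa using this
  · have := hup {j} (fun _ => 1) 1 zero_le_one (by simp)
    simpa using this

/-- Put `h = f - S_A f`. Then `F \ A` is greedy for `h`, so quasi-greediness bounds that projection.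
The coefficients of `f` on `A \ F` are dominated by those on `F \ A`, a set at least as large, so
the two democracy estimates bound that part by `‖h‖`. -/
theorem almostGreedy [CompleteSpace X] (hK : Spreading e K)
    (hy : ∀ n, ‖y n‖ ≤ C ∧ ‖y.coord n‖ ≤ C) (hR0 : 0 < R)
    (hR : ∀ r : ℕ, ∑ n ∈ range (r + 1), sumNorm e (2 ^ n) ≤ R * sumNorm e (2 ^ r)) :
    AlmostGreedy (Γ.basis hK hy) := by
  have h0 := hK.pos
  obtain ⟨M₁, hM₁, hup⟩ := Γ.exists_upper hK hy hR0 hR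
  obtain ⟨M₂, hM₂, hlow⟩ := Γ.exists_lower hK hy
  obtain ⟨M₃, hM₃, hqg⟩ := Γ.exists_quasiGreedy hK hy hR0 hR
  refine ⟨1 + M₃ + M₁ * (K * M₂), fun f A F hAF hF => ?_⟩
  have hF : ∀ j ∉ F, ∀ k ∈ F, ‖Γ.coord y j f‖ ≤ ‖Γ.coord y k f‖ := hF
  rw [proj_basis, proj_basis]
  set h := f - ∑ k ∈ A, Γ.coord y k f • Γ.vec y k with hh
  have hcoord : ∀ k, Γ.coord y k h = if k ∈ A then 0 else Γ.coord y k f := fun k => by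
    rw [hh, map_sub, map_sum]
    simp only [map_smul, coord_vec, smul_eq_mul, mul_ite, mul_one, mul_zero, sum_ite_eq]
    split_ifs <;> simp
  have hcoordA : ∀ k ∈ F \ A, Γ.coord y k h = Γ.coord y k f := fun k hk => by
    rw [hcoord, if_neg (mem_sdiff.1 hk).2]
  have h1 : f - ∑ k ∈ F, Γ.coord y k f • Γ.vec y k =
      h - ∑ k ∈ F \ A, Γ.coord y k h • Γ.vec y k + ∑ k ∈ A \ F, Γ.coord y k f • Γ.vec y k := by
    have h4 : ∑ k ∈ F \ A, Γ.coord y k h • Γ.vec y k =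
        ∑ k ∈ F \ A, Γ.coord y k f • Γ.vec y k :=
      sum_congr rfl fun k hk => by rw [hcoordA k hk]
    rw [h4, hh]
    have h2 := sum_inter_add_sum_sdiff F A fun k => Γ.coord y k f • Γ.vec y k
    have h3 := sum_inter_add_sum_sdiff A F fun k => Γ.coord y k f • Γ.vec y k
    rw [inter_comm] at h3
    rw [← h2, ← h3]
    abel
  have h2 := hqg h (F \ A) fun j hj k hk => by
    rw [hcoordA k hk, hcoord]
    split_ifs with hjA
    · simp
    · exact hF j (fun hjF => hj (mem_sdiff.2 ⟨hjF, hjA⟩)) k (mem_sdiff.1 hk).1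
  have hcard : (A \ F).card ≤ (F \ A).card := by
    have h3 := card_inter_add_card_sdiff A F
    have h4 := card_inter_add_card_sdiff F A
    rw [inter_comm] at h4
    omega
  have h3 : ‖∑ k ∈ A \ F, Γ.coord y k f • Γ.vec y k‖ ≤ M₁ * (K * (M₂ * ‖h‖)) := by
    rcases (F \ A).eq_empty_or_nonempty with he | hne
    · rw [he, card_empty, Nat.le_zero, card_eq_zero] at hcard
      rw [hcard, sum_empty, norm_zero]
      positivity
    · obtain ⟨k₀, hk₀, hmin⟩ := exists_min_image (F \ A) (fun k => ‖Γ.coord y k h‖) hne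
      set t := ‖Γ.coord y k₀ h‖ with ht
      have ht0 : 0 ≤ t := norm_nonneg _
      have h4 := hup (A \ F) (fun k => Γ.coord y k f) t ht0 fun k hk => by
        rw [ht, hcoordA k₀ hk₀]
        exact hF k (mem_sdiff.1 hk).2 k₀ (mem_sdiff.1 hk₀).1
      refine h4.trans (mul_le_mul_of_nonneg_left ?_ hM₁.le)
      calc _ ≤ t * (K * sumNorm e (F \ A).card) := by gcongr; exact hK.sumNorm_mono hcard
        _ = K * (t * sumNorm e (F \ A).card) := by ring
        _ ≤ _ := mul_le_mul_of_nonneg_left (hlow h _ t ht0 hmin) h0.le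
  rw [h1]
  refine (norm_add_le _ _).trans ((add_le_add (norm_sub_le _ _) le_rfl).trans ?_)
  calc _ ≤ ‖h‖ + M₃ * ‖h‖ + M₁ * (K * (M₂ * ‖h‖)) := add_le_add (add_le_add le_rfl h2) h3
    _ = _ := by ring

theorem fundamentalFunction_equiv (hK : Spreading e K)
    (hy : ∀ n, ‖y n‖ ≤ C ∧ ‖y.coord n‖ ≤ C) (hR0 : 0 < R)
    (hR : ∀ r : ℕ, ∑ n ∈ range (r + 1), sumNorm e (2 ^ n) ≤ R * sumNorm e (2 ^ r))
    (I : Set ℕ) : EquivOn I (fundamentalFunction (Γ.basis hK hy)) (sumNorm e) := by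
  have h0 := hK.pos
  obtain ⟨M₁, hM₁, hup⟩ := Γ.exists_upper hK hy hR0 hR
  obtain ⟨M₂, hM₂, hlow⟩ := Γ.exists_lower hK hy
  refine ⟨M₁ * K + M₂, by positivity, fun m _ => ?_⟩
  have hle : sumNorm e m ≤ M₂ * fundamentalFunction (Γ.basis hK hy) m := by
    have h1 := hlow (∑ j ∈ range m, Γ.vec y j) (range m) 1 zero_le_one fun k hk => by
      rw [coord_sum_vec Γ _ hk, norm_one]
    rw [one_mul, card_range] at h1
    refine h1.trans (mul_le_mul_of_nonneg_left ?_ hM₂.le)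
    exact le_csSup (bddAbove_fundamentalFunction _ (Γ.semiNormalized hK hy hR0 hR) m)
      ⟨range m, by simp, rfl⟩
  have hge : fundamentalFunction (Γ.basis hK hy) m ≤ M₁ * (K * sumNorm e m) := by
    refine csSup_le ⟨_, ∅, by simp, rfl⟩ ?_
    rintro r ⟨A, hA, rfl⟩
    have h1 := hup A (fun _ => 1) 1 zero_le_one (by simp)
    rw [← sum_vec_eq, one_mul] at h1
    exact h1.trans (by gcongr; exact hK.sumNorm_mono hA)
  have h1 := sumNorm_nonneg e m
  have h2 : 0 ≤ fundamentalFunction (Γ.basis hK hy) m :=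
    (mul_nonneg_iff_of_pos_left hM₂).1 (h1.trans hle)
  constructor
  · nlinarith [mul_nonneg hM₂.le h1]
  · nlinarith [mul_nonneg (mul_nonneg hM₁.le h0.le) h2]

/-- A vector supported below `m` meets at most `Nat.log 2 m + 1` levels, and projections inside one
level are uniformly bounded. -/
theorem exists_conditionality_le (hK : Spreading e K)
    (hy : ∀ n, ‖y n‖ ≤ C ∧ ‖y.coord n‖ ≤ C) :
    ∃ M : ℝ, 0 < M ∧ ∀ m : ℕ, 2 ≤ m →
      conditionalityConstant (Γ.basis hK hy) m ≤ M * Real.log m := by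
  have h0 := hK.pos
  have hC : 0 ≤ C := (norm_nonneg _).trans (hy 0).1
  obtain ⟨M₁, hM₁, hlev⟩ := Γ.norm_sum_level_le hK hy
  set M₂ := M₁ * (C * ‖Γ.toX‖ + K * ‖Γ.toS‖) with hM₂
  have hlog2 : 0 < Real.log 2 := Real.log_pos one_lt_two
  have hM₂0 : 0 ≤ M₂ := by positivity
  refine ⟨2 * M₂ / Real.log 2 + 1, by positivity, fun m hm => ?_⟩
  have hlogm : Real.log 2 ≤ Real.log m := Real.log_le_log two_pos (by exact_mod_cast hm)
  have hone : ∀ (n : ℕ) (D : Finset ℕ) (f : Y), D ⊆ levelSet n →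
      ‖∑ k ∈ D, Γ.coord y k f • Γ.vec y k‖ ≤ M₂ * ‖f‖ := fun n D f hD => by
    refine (hlev n D f hD).trans ?_
    rw [hM₂, mul_assoc]
    gcongr
    have h1 : ‖y.coord n (Γ.toX f)‖ ≤ C * (‖Γ.toX‖ * ‖f‖) :=
      ((y.coord n).le_of_opNorm_le (hy n).2 _).trans (by gcongr; exact Γ.toX.le_opNorm f)
    have h2 : ‖∑ k ∈ levelSet n, e.coord k (Γ.toS f) • e k‖ ≤ K * (‖Γ.toS‖ * ‖f‖) :=
      (hK.proj _ _).trans (by gcongr; exact Γ.toS.le_opNorm f)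
    linarith
  have hvec : Γ.vec y 0 ≠ 0 := fun h => by
    have := Γ.coord_vec y 0 0
    simp [h] at this
  refine csSup_le ⟨_, Γ.vec y 0, ∅, hvec, fun j hj => ?_, rfl⟩ ?_
  · change Γ.coord y j (Γ.vec y 0) = 0
    rw [coord_vec, if_neg (by omega)]
  rintro r ⟨f, A, hf, hsupp, rfl⟩
  have hsupp : ∀ j, m ≤ j → Γ.coord y j f = 0 := hsupp
  rw [div_le_iff₀ (norm_pos_iff.2 hf), proj_basis]
  have h1 : ∑ k ∈ A, Γ.coord y k f • Γ.vec y k =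
      ∑ n ∈ range (Nat.log 2 m + 1),
        ∑ k ∈ A.filter (· < m) with level k = n, Γ.coord y k f • Γ.vec y k := by
    rw [sum_fiberwise_of_maps_to, sum_filter_of_ne]
    · intro k _ hk
      by_contra! hmk
      exact hk (by rw [hsupp k hmk, zero_smul])
    · intro k hk
      rw [mem_range, Nat.lt_succ_iff, level]
      exact Nat.log_mono_right (mem_filter.1 hk).2
  have hlogn : (Nat.log 2 m : ℝ) ≤ Real.log m / Real.log 2 := by
    rw [le_div_iff₀ hlog2, ← Real.log_pow]
    have h2 := Nat.pow_log_le_self 2 (show m ≠ 0 by omega)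
    exact Real.log_le_log (by positivity) (by exact_mod_cast h2)
  have h2 : (1 : ℝ) ≤ Real.log m / Real.log 2 := by rwa [one_le_div hlog2]
  rw [h1]
  calc _ ≤ ∑ n ∈ range (Nat.log 2 m + 1), M₂ * ‖f‖ :=
        (norm_sum_le _ _).trans (sum_le_sum fun n _ => hone n _ f fun k hk =>
          mem_levelSet.2 (mem_filter.1 hk).2)
    _ = (Nat.log 2 m + 1) * (M₂ * ‖f‖) := by
        rw [sum_const, card_range, nsmul_eq_mul]; push_cast; rfl
    _ ≤ (Real.log m / Real.log 2 + Real.log m / Real.log 2) * (M₂ * ‖f‖) := by gcongr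
    _ = 2 * M₂ / Real.log 2 * Real.log m * ‖f‖ := by ring
    _ ≤ _ := by
        gcongr
        linarith

/-- The embedding `inX` turns the projection of `y` onto a set `A` into the projection onto the
union of the levels in `A`. So conditionality of `y` on about `log m` vectors is inherited on the
first `m` indices. -/
theorem exists_le_conditionality (hK : Spreading e K)
    (hy : ∀ n, ‖y n‖ ≤ C ∧ ‖y.coord n‖ ≤ C)
    (hcond : ∃ c : ℝ, 0 < c ∧ ∀ i : ℕ, ∃ (f : X) (A : Finset ℕ), f ≠ 0 ∧
        (∀ n, 4 * 2 ^ i ≤ n → y.coord n f = 0) ∧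
        c * 2 ^ i * ‖f‖ ≤ ‖∑ n ∈ A, y.coord n f • y n‖) :
    ∃ M : ℝ, 0 < M ∧ ∀ m : ℕ, 2 ≤ m →
      Real.log m ≤ M * conditionalityConstant (Γ.basis hK hy) m := by
  obtain ⟨c, hc, hcond⟩ := hcond
  set N := (‖Γ.toX‖ + 1) * (‖Γ.inX‖ + 1) with hN
  have hN0 : 0 < N := by positivity
  -- With `r = Nat.log 2 m`, `log m ≤ 2 * r`. If `r < 4` this is at most `8`, and `1` bounds the
  -- conditionality constant below; otherwise `r ≤ 8 * 2 ^ i` gives the `16`.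
  refine ⟨16 * N / c + 8, by positivity, fun m hm => ?_⟩
  have hbdd := bddAbove_conditionalityConstant (Γ.basis hK hy) m
  have hvec : Γ.vec y 0 ≠ 0 := fun h => by
    have := Γ.coord_vec y 0 0
    simp [h] at this
  have hone : 1 ≤ conditionalityConstant (Γ.basis hK hy) m := by
    refine le_csSup hbdd ⟨Γ.vec y 0, {0}, hvec, fun j hj => ?_, ?_⟩
    · change Γ.coord y j (Γ.vec y 0) = 0
      rw [coord_vec, if_neg (by omega)]
    · rw [proj_basis, sum_singleton, coord_vec, if_pos rfl, one_smul,
        div_self (norm_ne_zero_iff.2 hvec)]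
  set r := Nat.log 2 m with hr
  obtain ⟨hr1, hr2⟩ := (log_two_eq_iff (show m ≠ 0 by omega)).1 hr.symm
  have hr0 : 1 ≤ r := (Nat.le_log_iff_pow_le one_lt_two (by omega)).2 (by simpa using hm)
  have hlog : Real.log m ≤ 2 * r := by
    have h1 : Real.log m ≤ Real.log ((2 : ℝ) ^ (r + 1)) :=
      Real.log_le_log (by positivity) (by exact_mod_cast hr2.le)
    rw [Real.log_pow] at h1
    have h2 : Real.log 2 ≤ 1 := by linarith [Real.log_two_lt_d9]
    have h3 : (1 : ℝ) ≤ r := by exact_mod_cast hr0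
    push_cast at h1
    nlinarith
  have hNc : 0 < N / c := by positivity
  rcases lt_or_ge r 4 with h4 | h4
  · have h5 : (r : ℝ) ≤ 4 := by exact_mod_cast h4.le
    have h6 : 0 ≤ 16 * N / c := by positivity
    nlinarith
  -- The largest `i` with `4 * 2 ^ i ≤ r`, so that the levels carrying the test vector lie below
  -- `r`.
  · set i := Nat.log 2 (r / 4) with hi
    obtain ⟨hi1, hi2⟩ := (log_two_eq_iff (show r / 4 ≠ 0 by omega)).1 hi.symm
    rw [pow_succ] at hi2
    obtain ⟨f, A, hf, hsupp, hA⟩ := hcond i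
    have hinj : ∀ g, ‖g‖ ≤ (‖Γ.toX‖ + 1) * ‖Γ.inX g‖ := fun g => by
      have := Γ.toX.le_opNorm (Γ.inX g)
      rw [Γ.toX_inX] at this
      linarith [norm_nonneg (Γ.inX g)]
    have hin : ‖Γ.inX f‖ ≤ (‖Γ.inX‖ + 1) * ‖f‖ := by
      linarith [Γ.inX.le_opNorm f, norm_nonneg f]
    have hne : Γ.inX f ≠ 0 := fun h => by
      have := hinj f
      rw [h, norm_zero, mul_zero, norm_le_zero_iff] at this
      exact hf this
    have hproj : ∑ k ∈ A.biUnion levelSet, Γ.coord y k (Γ.inX f) • Γ.vec y k =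
        Γ.inX (∑ n ∈ A, y.coord n f • y n) := by
      rw [sum_biUnion, map_sum]
      · refine sum_congr rfl fun n _ => ?_
        rw [sum_levelSet, Γ.toX_inX, Γ.toS_inX]
        simp
      · intro n _ n' _ hnn'
        refine disjoint_left.2 fun k hk hk' => hnn' ?_
        rw [← mem_levelSet.1 hk, ← mem_levelSet.1 hk']
    have hle : ‖Γ.inX (∑ n ∈ A, y.coord n f • y n)‖ / ‖Γ.inX f‖ ≤
        conditionalityConstant (Γ.basis hK hy) m := by
      refine le_csSup hbdd ⟨Γ.inX f, A.biUnion levelSet, hne, fun j hj => ?_, ?_⟩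
      · change Γ.coord y j (Γ.inX f) = 0
        have h5 : r ≤ level j := Nat.log_mono_right (by omega)
        rw [coord_apply, base, Γ.toX_inX, Γ.toS_inX, hsupp _ (by omega)]
        simp
      · rw [proj_basis, hproj]
    have h5 : c * 2 ^ i / N ≤ ‖Γ.inX (∑ n ∈ A, y.coord n f • y n)‖ / ‖Γ.inX f‖ := by
      rw [div_le_div_iff₀ hN0 (norm_pos_iff.2 hne)]
      calc c * 2 ^ i * ‖Γ.inX f‖ ≤ c * 2 ^ i * ((‖Γ.inX‖ + 1) * ‖f‖) := by gcongr
        _ = (‖Γ.inX‖ + 1) * (c * 2 ^ i * ‖f‖) := by ring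
        _ ≤ (‖Γ.inX‖ + 1) *
            ((‖Γ.toX‖ + 1) * ‖Γ.inX (∑ n ∈ A, y.coord n f • y n)‖) := by
            exact mul_le_mul_of_nonneg_left (hA.trans (hinj _)) (by positivity)
        _ = _ := by rw [hN]; ring
    have h6 : (r : ℝ) ≤ 8 * 2 ^ i := by
      have : r ≤ 8 * 2 ^ i := by omega
      exact_mod_cast this
    calc Real.log m ≤ 16 * 2 ^ i := by linarith
      _ = 16 * N / c * (c * 2 ^ i / N) := by field_simp
      _ ≤ 16 * N / c * conditionalityConstant (Γ.basis hK hy) m := by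
          gcongr; exact h5.trans hle
      _ ≤ _ := by linarith

end Main

end Gluing

end

end GreedyBases

theorem theorem4p8 {𝕜 : Type*} [RCLike 𝕜]
    {X : Type*} [NormedAddCommGroup X] [NormedSpace 𝕜 X] [CompleteSpace X]
    {S : Type*} [NormedAddCommGroup S] [NormedSpace 𝕜 S] [CompleteSpace S]
    (x : SchauderBasis 𝕜 X) (hx : GreedyBases.TypeP x)
    (e : SchauderBasis 𝕜 S) (he : GreedyBases.Subsymmetric e)
    (hSX : GreedyBases.ComplementablyEmbeds 𝕜 S X)
    (hS : GreedyBases.HasNontrivialType S) :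
    ∃ b : SchauderBasis 𝕜 X,
      GreedyBases.SemiNormalized b ∧
      GreedyBases.AlmostGreedy b ∧
      GreedyBases.EquivOn {m | 1 ≤ m} (GreedyBases.fundamentalFunction b)
        (fun m => ‖∑ j ∈ Finset.range m, e j‖) ∧
      GreedyBases.EquivOn {m | 2 ≤ m} (GreedyBases.conditionalityConstant b)
        (fun m => Real.log m) := by
  obtain ⟨K, hK⟩ := he.exists_spreading
  obtain ⟨R, hR0, hR⟩ := hK.sum_sumNorm_le hS
  obtain ⟨y, ⟨C, -, hy⟩, hcond⟩ := hx.exists_conditional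
  -- The space decomposed is `X` itself, so the glued basis is a basis of `X`.
  obtain ⟨Γ⟩ := hK.exists_gluing hSX
  obtain ⟨M₁, hM₁, hle⟩ := Γ.exists_conditionality_le hK hy
  obtain ⟨M₂, hM₂, hge⟩ := Γ.exists_le_conditionality hK hy hcond
  refine ⟨Γ.basis hK hy, Γ.semiNormalized hK hy hR0 hR, Γ.almostGreedy hK hy hR0 hR,
    Γ.fundamentalFunction_equiv hK hy hR0 hR _, M₁ + M₂, by positivity, fun m hm => ?_⟩
  have hlog : 0 ≤ Real.log m := Real.log_natCast_nonneg m
  have h1 := hle m hm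
  have h2 := hge m hm
  have h3 : 0 ≤ GreedyBases.conditionalityConstant (Γ.basis hK hy) m :=
    (mul_nonneg_iff_of_pos_left hM₂).1 (hlog.trans h2)
  constructor
  · nlinarith [mul_nonneg hM₂.le hlog]
  · nlinarith [mul_nonneg hM₁.le h3]
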